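/- Let $d\in\{2,3\}$, let $\mathbb S^d\subset\mathbb R^{d+1}$ be the round unit sphere with its surface measure, and let $\Delta\ge 0$ be its (positive) Laplace–Beltrami operator, with eigenvalues $\lambda_\ell^2=\ell(\ell+d-1)$, $\ell\in\mathbb N=\{0,1,2,\dots\}$. For $q\in\mathbb S^d$ let $Z_\ell^q\in\ker(\Delta-\lambda_\ell^2)$ be the zonal harmonic at $q$, i.e. the unique element of $\ker(\Delta-\lambda_\ell^2)$ with $\langle Z_\ell^q,u\rangle_{L^2}=u(q)$ for all $u\in\ker(\Delta-\lambda_\ell^2)$, and set $z_\ell^q=Z_\ell^q/\|Z_\ell^q\|_{L^2(\mathbb S^d)}$. Fix $q\in\mathbb S^d$ and $Q=\{q,-q\}$. For $\beta=(\beta_q,\beta_{-q})\in\mathbb C^2$ and $h>0$ with $h^{-2}\notin\operatorname{Spec}(\Delta)$ let $$G_h^{Q,\beta}=\sum_{\ell\in\mathbb N}\frac{1}{\lambda_\ell^2-h^{-2}}\bigl(\beta_qZ_\ell^q+\beta_{-q}Z_\ell^{-q}\bigr)\in L^2(\mathbb S^d),\qquad g_h^{Q,\beta}=\frac{G_h^{Q,\beta}}{\|G_h^{Q,\beta}\|_{L^2(\mathbb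 S^d)}}\quad\text{if }G_h^{Q,\beta}\neq0 .$$ **Theorem 4.4.** Let $(h_n)_{n\in\mathbb N}\subset(0,1)$ and $(\beta_n)_{n\in\mathbb N}\subset\mathbb C^2$, and for every $n$ let $\ell_n\in\mathbb N$ and $\sigma_n\in[0,1)$ be such that $$h_n^{-2}=(\ell_n+\sigma_n)(\ell_n+\sigma_n+d-1).$$ Assume that 1. $h_n\to0^+$ and $h_n^{-2}\notin\operatorname{Spec}(\Delta)$ for all $n$ (thus $\sigma_n\in(0,1)$ for all $n$); 2. $\beta_n\to\beta\in\mathbb C^2$ with $\beta\ne0$; 3. $\ell_n$ is even for all $n$, or $\ell_n$ is odd for all $n$; set $\rho=(-1)^{\ell_n}$; 4. $\sigma_n\to\sigma\in(0,1)$. Set $$C_{\sigma,\beta,\rho}=\Bigl(\sum_{k\in\mathbb Z}\frac{|\beta_q+(-1)^k\rho\,\beta_{-q}|^2}{(k-\sigma)^2}\Bigr)^{1/2}.$$ Then $0<C_{\sigma,\beta,\rho}<\infty$, and there exists $C>1$ such that for every integer $\Upsilon\ge1$ there exists $\nu\in\mathbb N$ such that for all $n\ge\nu$ one has $\ell_n\ge\Upsilon$,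 $G_{h_n}^{Q,\beta_n}\neq0$, and $$\Bigl\|g_{h_n}^{Q,\beta_n}-\frac1{C_{\sigma,\beta,\rho}}\sum_{|k|\le\Upsilon}\frac{\beta_q+(-1)^k\rho\,\beta_{-q}}{k-\sigma}\,z_{\ell_n+k}^q\Bigr\|_{L^2(\mathbb S^d)}\le C\Bigl[\Upsilon h_n+|\sigma_n-\sigma|+|\beta_n-\beta|+\Upsilon^{-1/2}\Bigr].$$ -/

import Mathlib

open scoped ContDiff Manifold

noncomputable section

/-- The ambient Euclidean space of dimension `d + 1`. -/
abbrev Ambient (d : ℕ) : Type := EuclideanSpace ℝ (Fin (d + 1))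

/-- The unit sphere of dimension `d`. -/
abbrev Sph (d : ℕ) : Type := Metric.sphere (0 : Ambient d) 1

/-- The canonical surface measure of the unit sphere. -/
abbrev surfaceMeasure (d : ℕ) : MeasureTheory.Measure (Sph d) :=
  (MeasureTheory.volume : MeasureTheory.Measure (Ambient d)).toSphere

/-- The complex Hilbert space of square-integrable functions on the sphere. -/
abbrev L2Sph (d : ℕ) : Type := MeasureTheory.Lp ℂ 2 (surfaceMeasure d)

/-- The class in `L²` of a continuous function on the sphere. -/
abbrev toL2 {d : ℕ} (u : C(Sph d, ℂ)) : L2Sph d :=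
  ContinuousMap.toLp 2 (surfaceMeasure d) ℂ u

/-- The extension of a function on the sphere that is constant along rays from the origin
(its value at the origin is irrelevant). -/
def radialExtension {d : ℕ} (u : Sph d → ℂ) (y : Ambient d) : ℂ :=
  if hy : y ≠ 0 then u ⟨‖y‖⁻¹ • y, by simp [norm_smul, norm_ne_zero_iff.mpr hy]⟩ else 0

/-- The positive Laplace–Beltrami operator of the round sphere, for smooth `u`: minus the Euclidean
Laplacian of the extension of `u` that is constant along rays, restricted to the sphere. -/
def sphereLaplacian {d : ℕ} (u : Sph d → ℂ) (x : Sph d) : ℂ :=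
  -(Laplacian.laplacian (radialExtension u) (x : Ambient d))

/-- The kernel of `Δ - μ`. By elliptic regularity all its elements are smooth functions. -/
def laplaceKer (d : ℕ) (μ : ℝ) : Set C(Sph d, ℂ) :=
  {u | ContMDiff (𝓡 d) 𝓘(ℝ, ℂ) ∞ u ∧ ∀ x, sphereLaplacian u x = (μ : ℂ) * u x}

/-- The spectrum of the Laplacian of the sphere. Since the sphere is compact the spectrum is the
set of eigenvalues. -/
def laplaceSpec (d : ℕ) : Set ℝ :=
  {μ | ∃ u ∈ laplaceKer d μ, u ≠ 0}

/-- The `ℓ`-th eigenvalue `λ_ℓ² = ℓ (ℓ + d - 1)`. -/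
def lamSq (d ℓ : ℕ) : ℝ := (ℓ : ℝ) * ((ℓ : ℝ) + ((d : ℝ) - 1))

/-- `Z` is the zonal harmonic at `q` of energy `λ_ℓ²`: it lies in `ker (Δ - λ_ℓ²)` and represents
the evaluation at `q` on this space. -/
def IsZonalHarmonic {d : ℕ} (ℓ : ℕ) (q : Sph d) (Z : C(Sph d, ℂ)) : Prop :=
  Z ∈ laplaceKer d (lamSq d ℓ) ∧
    ∀ u ∈ laplaceKer d (lamSq d ℓ), inner ℂ (toL2 Z) (toL2 u) = u q

open Classical in
/-- The zonal harmonic `Z_ℓ^q`. It exists because `ker (Δ - λ_ℓ²)` has finite dimension, and it is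
unique. -/
def zonalHarmonic {d : ℕ} (ℓ : ℕ) (q : Sph d) : C(Sph d, ℂ) :=
  if hZ : ∃ Z : C(Sph d, ℂ), IsZonalHarmonic ℓ q Z then hZ.choose else 0

/-- The zonal harmonic `Z_ℓ^q` as an element of `L²`. -/
def zonalL2 {d : ℕ} (ℓ : ℕ) (q : Sph d) : L2Sph d := toL2 (zonalHarmonic ℓ q)

/-- The normalized zonal harmonic `z_ℓ^q`. -/
def normZonal {d : ℕ} (ℓ : ℕ) (q : Sph d) : L2Sph d :=
  ((‖zonalL2 ℓ q‖⁻¹ : ℝ) : ℂ) • zonalL2 ℓ q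

/-- The linear combination `G_h^{Q,β}` of Green's functions at the finite family of points `Q`, with
weights `β`, at an energy `h⁻²` outside the spectrum (the series converges in `L²` for
`d = 2, 3`). -/
def greenComb {d : ℕ} {ι : Type} [Fintype ι] (h : ℝ) (Q : ι → Sph d)
    (β : EuclideanSpace ℂ ι) : L2Sph d :=
  ∑' ℓ : ℕ, (1 / ((lamSq d ℓ - h ^ (-2 : ℤ) : ℝ) : ℂ)) • ∑ i, β i • zonalL2 ℓ (Q i)

/-- The normalized function `g_h^{Q,β}`. -/
def normGreenComb {d : ℕ} {ι : Type} [Fintype ι] (h : ℝ) (Q : ι → Sph d)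
    (β : EuclideanSpace ℂ ι) : L2Sph d :=
  ((‖greenComb h Q β‖⁻¹ : ℝ) : ℂ) • greenComb h Q β

/-- The pair of antipodal points `q, -q`. A vector `β` of `ℂ²` has the components `β 0 = β_q` and
`β 1 = β_{-q}`. -/
def antipodalPair {d : ℕ} (q : Sph d) : Fin 2 → Sph d := ![q, -q]

/-- The constant `C_{σ,β,ρ}`. -/
def quasimodeConst (σ : ℝ) (β : EuclideanSpace ℂ (Fin 2)) (ρ : ℂ) : ℝ :=
  Real.sqrt (∑' k : ℤ, ‖β 0 + (-1 : ℂ) ^ k * ρ * β 1‖ ^ 2 / ((k : ℝ) - σ) ^ 2)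

end

/-! Since Z_ℓ^{-q} = (-1)^ℓ Z_ℓ^q, the Green combination is a series in the single orthonormal
family z_ℓ^q. Write L, s for ℓ_n, σ_n and ℓ = L + k. The denominator factors as λ_ℓ² - h⁻² = (k -
s)(L + ℓ + s + d - 1). Up to the positive scalar ‖Z_L‖ / (2L + d - 1), which normalization removes,
the coefficient of z_ℓ is therefore (β_q + (-1)^k ρ β_{-q}) / (k - s) times `greenRatio`
(`greenComb_eq`). As ‖Z_ℓ‖² is proportional to 2ℓ + 1 for d = 2 and to (ℓ + 1)² for d = 3, this
ratio is at most 2 everywhere and 1 + O(Υ / L) for |k| ≤ Υ. The error against the limit coefficients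
is thus O((Υ / L + |s - σ| + |β_n - β|) / (|k| + 1)) in the window and O(1 / (|k| + 1)) outside it;
summing squares gives `norm_tsum_greenCoeff_sub_le`. The truncated limit has norm C + O(Υ^{-1/2})
(`abs_quasimodeConst_sub_norm_le`), and 1 / L = O(h).

The zonal harmonics must first be identified with multiples of P_ℓ(⟨q, x⟩), P_ℓ the Gegenbauer
polynomials. These are eigenfunctions by `gegen_ode` and `laplacian_zonal_polynomial`.
Eigenfunctions of different energies are orthogonal, by Green's identity in ℝ^{d+1} for functions
constant along rays. The reproducing property against an arbitrary smooth eigenfunction u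
(`zonalPairing_gegen_self`) needs no description of the eigenspace: by orthogonality, the pairings
with u and with P_ℓ are proportional functionals on polynomials, and polynomials peaking at q reveal
the factor. -/

noncomputable section

/-! ### Gegenbauer polynomials -/

open Polynomial

/-- The Gegenbauer polynomials of the sphere of dimension `d`, normalized to be `1` at `1`. -/
def gegen (d : ℕ) : ℕ → ℝ[X]
  | 0 => 1
  | 1 => X
  | n + 2 => C (((n : ℝ) + d)⁻¹) *
      (C (2 * (n : ℝ) + d + 1) * X * gegen d (n + 1) - C ((n : ℝ) + 1) * gegen d n)

theorem gegen_recurrence (d : ℕ) (hd : 0 < d) (n : ℕ) :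
    C ((n : ℝ) + d) * gegen d (n + 2) =
      C (2 * (n : ℝ) + d + 1) * X * gegen d (n + 1) - C ((n : ℝ) + 1) * gegen d n := by
  have h : (n : ℝ) + d ≠ 0 := by positivity
  rw [gegen, ← mul_assoc, ← C_mul, mul_inv_cancel₀ h, C_1, one_mul]

theorem gegen_eval_one (d : ℕ) (hd : 0 < d) : ∀ n, (gegen d n).eval 1 = 1
  | 0 => by simp [gegen]
  | 1 => by simp [gegen]
  | n + 2 => by
    have h : (n : ℝ) + d ≠ 0 := by positivity
    have h1 := congrArg (eval 1) (gegen_recurrence d hd n)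
    simp only [eval_mul, eval_C, eval_sub, eval_X, gegen_eval_one d hd n,
      gegen_eval_one d hd (n + 1)] at h1
    have : ((n : ℝ) + d) * eval 1 (gegen d (n + 2)) = ((n : ℝ) + d) * 1 := by linarith
    exact mul_left_cancel₀ h this

theorem gegen_eval_neg (d : ℕ) (t : ℝ) : ∀ n, (gegen d n).eval (-t) = (-1) ^ n * (gegen d n).eval t
  | 0 => by simp [gegen]
  | 1 => by simp [gegen]
  | n + 2 => by
    simp only [gegen, eval_mul, eval_C, eval_sub, eval_X, gegen_eval_neg d t n,
      gegen_eval_neg d t (n + 1)]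
    ring

/-- The two relations support each other in the induction: the second at n + 1 is the first at n
plus the recurrence, and the first at n + 1 comes from differentiating the recurrence and using
both. -/
theorem gegen_derivative (d : ℕ) (hd : 0 < d) (n : ℕ) :
    (1 - X ^ 2) * derivative (gegen d (n + 1)) =
        C ((n : ℝ) + 1) * (gegen d n - X * gegen d (n + 1)) ∧
      (1 - X ^ 2) * derivative (gegen d n) =
        C ((n : ℝ) + d - 1) * (X * gegen d n - gegen d (n + 1)) := by
  induction n with
  | zero => constructor <;> simp [gegen] <;> ring
  | succ n ih =>
    obtain ⟨h1, h2⟩ := ih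
    have hr := gegen_recurrence d hd n
    have h : C ((n : ℝ) + d) ≠ 0 := by
      rw [Ne, C_eq_zero]; positivity
    have hdr := congrArg derivative hr
    simp only [derivative_mul, derivative_sub, derivative_C, derivative_X] at hdr
    simp only [C_add, C_mul, C_sub, C_1, map_ofNat, Nat.cast_succ, map_natCast] at *
    constructor
    · apply mul_left_cancel₀ h
      linear_combination (1 - X ^ 2) * hdr + (2 * (n : ℝ[X]) + d + 1) * X * h1
        - ((n : ℝ[X]) + 1) * h2 + ((n : ℝ[X]) + 1 + 1) * X * hr
    · linear_combination h1 + hr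

/-- The Gegenbauer differential equation. -/
theorem gegen_ode (d : ℕ) (hd : 0 < d) (n : ℕ) :
    (1 - X ^ 2) * derivative (derivative (gegen d n)) - C (d : ℝ) * X * derivative (gegen d n) =
      - (C (lamSq d n) * gegen d n) := by
  obtain ⟨h1, h2⟩ := gegen_derivative d hd n
  have hX : (1 - X ^ 2 : ℝ[X]) ≠ 0 := by
    intro h
    simpa using congrArg (eval 0) h
  have hd2 := congrArg derivative h2
  simp only [derivative_mul, derivative_sub, derivative_C, derivative_X, derivative_one,
    derivative_X_pow] at hd2
  simp only [lamSq, C_add, C_mul, C_sub, C_1, map_natCast] at *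
  apply mul_left_cancel₀ hX
  simp only [Nat.add_one_sub_one, Nat.cast_ofNat] at hd2
  -- The derivative of the second relation, multiplied by 1 - X²; the two relations then eliminate
  -- P_{n+1}' and P_{n+1}.
  linear_combination (1 - X ^ 2) * hd2 + ((n : ℝ[X]) + d - 1) * X * h2
    - ((n : ℝ[X]) + d - 1) * h1 - (d - 2) * X * h2

/-- Every linear functional on polynomials that vanishes on all Gegenbauer polynomials is zero. -/
theorem linearMap_eq_zero_of_gegen {d : ℕ} (hd : 0 < d) {M : Type*} [AddCommGroup M] [Module ℝ M]
    (Φ : ℝ[X] →ₗ[ℝ] M) (h : ∀ n, Φ (gegen d n) = 0) : Φ = 0 := by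
  let S : Submodule ℝ ℝ[X] := Submodule.span ℝ (Set.range (gegen d))
  have hX : ∀ p ∈ S, X * p ∈ S := by
    intro p hp
    induction hp using Submodule.span_induction with
    | mem p hp =>
      obtain ⟨n, rfl⟩ := hp
      rcases n with _ | n
      · exact Submodule.subset_span ⟨1, by simp [gegen]⟩
      · have h2 : (2 * (n : ℝ) + d + 1) ≠ 0 := by positivity
        -- The recurrence read backwards makes the span stable under multiplication by X; as it
        -- contains 1, it contains every monomial.
        have : X * gegen d (n + 1) = (2 * (n : ℝ) + d + 1)⁻¹ •
            (((n : ℝ) + d) • gegen d (n + 2) + ((n : ℝ) + 1) • gegen d n) := by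
          rw [eq_inv_smul_iff₀ h2]
          simp only [smul_eq_C_mul]
          rw [gegen_recurrence d hd n]; ring
        rw [this]
        exact S.smul_mem _ (S.add_mem (S.smul_mem _ (Submodule.subset_span ⟨_, rfl⟩))
          (S.smul_mem _ (Submodule.subset_span ⟨_, rfl⟩)))
    | zero => simp
    | add p r _ _ h1 h2 => rw [mul_add]; exact S.add_mem h1 h2
    | smul a p _ h1 => rw [mul_smul_comm]; exact S.smul_mem _ h1
  have hpow : ∀ k : ℕ, (X : ℝ[X]) ^ k ∈ S := by
    intro k
    induction k with
    | zero => exact Submodule.subset_span ⟨0, by simp [gegen]⟩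
    | succ k ih => rw [pow_succ']; exact hX _ ih
  have hS : ∀ p ∈ S, Φ p = 0 := by
    intro p hp
    induction hp using Submodule.span_induction with
    | mem p hp => obtain ⟨n, rfl⟩ := hp; exact h n
    | zero => simp
    | add p r _ _ h1 h2 => simp [h1, h2]
    | smul a p _ h1 => simp [h1]
  ext k
  simpa [← X_pow_eq_monomial] using hS _ (hpow k)

end

/-! ### Functions constant along rays, and the Laplacian of zonal functions -/

noncomputable section

open scoped RealInnerProductSpace Topology EuclideanSpace
open MeasureTheory Set

/-- Radial projection onto the unit sphere. -/
def radialProj {d : ℕ} (y : ({0}ᶜ : Set (Ambient d))) : Sph d :=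
  ⟨‖(y : Ambient d)‖⁻¹ • (y : Ambient d), by
    have : (y : Ambient d) ≠ 0 := y.2
    simp [norm_smul, norm_ne_zero_iff.mpr this]⟩

theorem radialExtension_smul {d : ℕ} (u : Sph d → ℂ) {r : ℝ} (hr : 0 < r) (y : Ambient d) :
    radialExtension u (r • y) = radialExtension u y := by
  unfold radialExtension
  by_cases hy : y = 0
  · simp [hy]
  · have h1 : r • y ≠ 0 := smul_ne_zero hr.ne' hy
    rw [dif_pos h1, dif_pos hy]
    congr 1
    ext1
    simp only [norm_smul, Real.norm_eq_abs, abs_of_pos hr, mul_inv, smul_smul]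
    congr 1
    field_simp

theorem contDiffAt_radialExtension {d : ℕ} {u : Sph d → ℂ} (hu : ContMDiff (𝓡 d) 𝓘(ℝ, ℂ) ∞ u)
    {y : Ambient d} (hy : y ≠ 0) : ContDiffAt ℝ ∞ (radialExtension u) y := by
  let U : TopologicalSpace.Opens (Ambient d) := ⟨{0}ᶜ, isOpen_compl_singleton⟩
  have h1 : ContMDiff 𝓘(ℝ, Ambient d) 𝓘(ℝ, Ambient d) ∞
      (fun z : U => ‖(z : Ambient d)‖⁻¹ • (z : Ambient d)) := by
    intro z
    have hz : (z : Ambient d) ≠ 0 := z.2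
    have : ContDiffAt ℝ ∞ (fun z : Ambient d => ‖z‖⁻¹ • z) z :=
      ((contDiffAt_norm ℝ hz).inv (norm_ne_zero_iff.2 hz)).smul contDiffAt_id
    exact this.contMDiffAt.comp z (contMDiff_subtype_val z)
  have h2 : ContMDiff 𝓘(ℝ, Ambient d) (𝓡 d) ∞ (fun z : U => (radialProj ⟨z.1, z.2⟩ : Sph d)) :=
    ContMDiff.codRestrict_sphere h1 _
  have h3 := hu.comp h2
  have h4 : ContMDiffAt 𝓘(ℝ, Ambient d) 𝓘(ℝ, ℂ) ∞ (radialExtension u) ((⟨y, hy⟩ : U) : Ambient d) := by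
    rw [← contMDiffAt_subtype_iff]
    convert h3 ⟨y, hy⟩ using 1
    ext z
    have hz : (z : Ambient d) ≠ 0 := z.2
    simp [radialExtension, hz, radialProj]
  exact h4.contDiffAt

theorem iteratedFDeriv_two_diag {E F : Type*} [NormedAddCommGroup E] [NormedSpace ℝ E]
    [NormedAddCommGroup F] [NormedSpace ℝ F] {f : E → F} {x : E} (hf : ContDiffAt ℝ 2 f x) (e : E) :
    iteratedFDeriv ℝ 2 f x ![e, e] = fderiv ℝ (fun y => fderiv ℝ f y e) x e := by
  have h : DifferentiableAt ℝ (fderiv ℝ f) x :=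
    (hf.fderiv_right (m := 1) (by norm_num)).differentiableAt (by norm_num)
  rw [iteratedFDeriv_two_apply, fderiv_clm_apply h (by fun_prop)]
  simp

theorem laplacian_eq_sum_fderiv {d : ℕ} {F : Type*} [NormedAddCommGroup F] [NormedSpace ℝ F]
    {f : Ambient d → F} {x : Ambient d} (hf : ContDiffAt ℝ 2 f x) :
    Laplacian.laplacian f x = ∑ i, fderiv ℝ
      (fun y => fderiv ℝ f y (EuclideanSpace.basisFun (Fin (d + 1)) ℝ i)) x
        (EuclideanSpace.basisFun (Fin (d + 1)) ℝ i) := by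
  rw [InnerProductSpace.laplacian_eq_iteratedFDeriv_orthonormalBasis f
    (EuclideanSpace.basisFun (Fin (d + 1)) ℝ)]
  exact Finset.sum_congr rfl fun i _ => iteratedFDeriv_two_diag hf _

/-- The zonal function `x ↦ p ⟨q, x⟩` attached to a polynomial `p`. -/
def zonalFun {d : ℕ} (q : Sph d) (p : Polynomial ℝ) : C(Sph d, ℂ) where
  toFun x := ((p.eval ⟪(q : Ambient d), (x : Ambient d)⟫ : ℝ) : ℂ)
  continuous_toFun := by fun_prop

theorem zonalFun_apply {d : ℕ} (q : Sph d) (p : Polynomial ℝ) (x : Sph d) :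
    zonalFun q p x = ((p.eval ⟪(q : Ambient d), (x : Ambient d)⟫ : ℝ) : ℂ) := rfl

theorem contMDiff_zonalFun {d : ℕ} (q : Sph d) (p : Polynomial ℝ) :
    ContMDiff (𝓡 d) 𝓘(ℝ, ℂ) ∞ (zonalFun q p) := by
  have h : ContDiff ℝ ∞ (fun y : Ambient d => ((p.eval ⟪(q : Ambient d), y⟫ : ℝ) : ℂ)) := by
    have h1 : ContDiff ℝ ∞ (fun t : ℝ => p.eval t) := by
      simpa using p.contDiff_aeval (𝕜 := ℝ) (n := ∞)
    exact Complex.ofRealCLM.contDiff.comp (h1.comp (contDiff_const.inner ℝ contDiff_id))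
  exact h.contMDiff.comp (contMDiff_coe_sphere (m := ∞) (n := d) (E := Ambient d))

theorem hasFDerivAt_inv_norm {d : ℕ} {y : Ambient d} (hy : y ≠ 0) :
    HasFDerivAt (fun y : Ambient d => ‖y‖⁻¹) (-(‖y‖⁻¹ ^ 3) • innerSL ℝ y) y := by
  have h0 : ‖y‖ ≠ 0 := norm_ne_zero_iff.2 hy
  have h1 : HasFDerivAt (fun y : Ambient d => ‖y‖ ^ 2) (2 • innerSL ℝ y) y :=
    (hasStrictFDerivAt_norm_sq y).hasFDerivAt
  have h2 := (h1.sqrt (by positivity))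
  have h3 := (hasDerivAt_inv (x := √(‖y‖ ^ 2)) (by simpa using h0)).comp_hasFDerivAt y h2
  have h4 : (fun y : Ambient d => ‖y‖⁻¹) = (fun y => y⁻¹) ∘ (fun y : Ambient d => √(‖y‖ ^ 2)) := by
    ext z; simp
  rw [h4]
  refine h3.congr_fderiv ?_
  ext z
  simp [Real.sqrt_sq (norm_nonneg y)]
  ring

/-- The differential at `y` of `y ↦ ⟨a, y⟩ / ‖y‖`. -/
theorem hasFDerivAt_inner_mul_inv_norm {d : ℕ} (a : Ambient d) {y : Ambient d} (hy : y ≠ 0) :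
    HasFDerivAt (fun y : Ambient d => ⟪a, y⟫ * ‖y‖⁻¹)
      (⟪a, y⟫ • (-(‖y‖⁻¹ ^ 3) • innerSL ℝ y) + ‖y‖⁻¹ • innerSL ℝ a) y :=
  ((innerSL ℝ a).hasFDerivAt (x := y)).mul (hasFDerivAt_inv_norm hy)

/-- For t = ⟨q, y⟩ / ‖y‖ one has |∇t|² = 1 - t² and Δt = -d t on the unit sphere. Both come from the
coordinate formula `key` by Parseval. -/
theorem laplacian_zonal_polynomial {d : ℕ} (q x : Sph d) (p : Polynomial ℝ) :
    Laplacian.laplacian (fun y : Ambient d => p.eval (⟪(q : Ambient d), y⟫ * ‖y‖⁻¹)) (x : Ambient d)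
      = ((1 - Polynomial.X ^ 2) * p.derivative.derivative
          - Polynomial.C (d : ℝ) * Polynomial.X * p.derivative).eval ⟪(q : Ambient d), (x : Ambient d)⟫ := by
  have hx1 : ‖(x : Ambient d)‖ = 1 := by simp
  have hq1 : ‖(q : Ambient d)‖ = 1 := by simp
  have hx0 : (x : Ambient d) ≠ 0 := by rw [← norm_ne_zero_iff, hx1]; exact one_ne_zero
  have hcd : ContDiffAt ℝ 2 (fun y : Ambient d => p.eval (⟪(q : Ambient d), y⟫ * ‖y‖⁻¹)) x := by
    have h1 : ContDiff ℝ 2 (fun t : ℝ => p.eval t) := by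
      simpa using p.contDiff_aeval (𝕜 := ℝ) (n := 2)
    exact h1.contDiffAt.comp _ ((contDiffAt_const.inner ℝ contDiffAt_id).mul
      ((contDiffAt_norm ℝ hx0).inv (by simp)))
  set b := EuclideanSpace.basisFun (Fin (d + 1)) ℝ with hb
  have key : ∀ i, fderiv ℝ (fun y => fderiv ℝ
      (fun y : Ambient d => p.eval (⟪(q : Ambient d), y⟫ * ‖y‖⁻¹)) y (b i)) x (b i) =
      p.derivative.derivative.eval ⟪(q : Ambient d), (x : Ambient d)⟫ *
        (⟪(q : Ambient d), b i⟫ * ⟪b i, (q : Ambient d)⟫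
          - 2 * ⟪(q : Ambient d), (x : Ambient d)⟫ * (⟪(q : Ambient d), b i⟫ * ⟪b i, (x : Ambient d)⟫)
          + ⟪(q : Ambient d), (x : Ambient d)⟫ ^ 2 * (⟪(x : Ambient d), b i⟫ * ⟪b i, (x : Ambient d)⟫))
      + p.derivative.eval ⟪(q : Ambient d), (x : Ambient d)⟫ *
        (-2 * (⟪(q : Ambient d), b i⟫ * ⟪b i, (x : Ambient d)⟫)
          + 3 * ⟪(q : Ambient d), (x : Ambient d)⟫ * (⟪(x : Ambient d), b i⟫ * ⟪b i, (x : Ambient d)⟫)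
          - ⟪(q : Ambient d), (x : Ambient d)⟫) := by
    intro i
    have h1 : (fun y => fderiv ℝ
        (fun y : Ambient d => p.eval (⟪(q : Ambient d), y⟫ * ‖y‖⁻¹)) y (b i)) =ᶠ[𝓝 (x : Ambient d)]
        fun y => p.derivative.eval (⟪(q : Ambient d), y⟫ * ‖y‖⁻¹) *
          (⟪(q : Ambient d), y⟫ * (-(‖y‖⁻¹ ^ 3) * ⟪b i, y⟫) + ‖y‖⁻¹ * ⟪(q : Ambient d), b i⟫) := by
      filter_upwards [isOpen_ne.mem_nhds hx0] with y hy
      have := (p.hasDerivAt (⟪(q : Ambient d), y⟫ * ‖y‖⁻¹)).comp_hasFDerivAt y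
        (hasFDerivAt_inner_mul_inv_norm (q : Ambient d) hy)
      have := this.fderiv
      simp only [Function.comp_def] at this
      rw [this]
      simp [real_inner_comm]
      ring
    rw [h1.fderiv_eq]
    have h2 := (p.derivative.hasDerivAt (⟪(q : Ambient d), (x : Ambient d)⟫ * ‖(x : Ambient d)‖⁻¹)).comp_hasFDerivAt
      (x : Ambient d) (hasFDerivAt_inner_mul_inv_norm (q : Ambient d) hx0)
    have hn := hasFDerivAt_inv_norm hx0
    have h3 := h2.mul ((((innerSL ℝ (q : Ambient d)).hasFDerivAt (x := (x : Ambient d))).mul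
      ((hn.pow 3).neg.mul ((innerSL ℝ (b i)).hasFDerivAt (x := (x : Ambient d))))).add
        (hn.mul_const ⟪(q : Ambient d), b i⟫))
    have h4 := h3.fderiv
    change fderiv ℝ (fun y : Ambient d => p.derivative.eval (⟪(q : Ambient d), y⟫ * ‖y‖⁻¹) *
          (⟪(q : Ambient d), y⟫ * (-(‖y‖⁻¹ ^ 3) * ⟪b i, y⟫) + ‖y‖⁻¹ * ⟪(q : Ambient d), b i⟫)) _ = _
      at h4
    rw [h4]
    simp [hx1, real_inner_comm, -EuclideanSpace.basisFun_inner, -EuclideanSpace.inner_basisFun_real]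
    ring
  rw [laplacian_eq_sum_fderiv hcd]
  simp only [← hb, key]
  rw [Finset.sum_add_distrib, ← Finset.mul_sum, ← Finset.mul_sum]
  simp only [Finset.sum_add_distrib, Finset.sum_sub_distrib, ← Finset.mul_sum,
    OrthonormalBasis.sum_inner_mul_inner, real_inner_self_eq_norm_sq, hx1, hq1]
  simp
  ring

theorem zonalFun_mem_laplaceKer {d : ℕ} (q : Sph d) {p : Polynomial ℝ} {μ : ℝ}
    (hp : (1 - Polynomial.X ^ 2) * p.derivative.derivative
      - Polynomial.C (d : ℝ) * Polynomial.X * p.derivative = -(Polynomial.C μ * p)) :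
    zonalFun q p ∈ laplaceKer d μ := by
  refine ⟨contMDiff_zonalFun q _, fun x => ?_⟩
  have hx1 : ‖(x : Ambient d)‖ = 1 := by simp
  have hx0 : (x : Ambient d) ≠ 0 := by rw [← norm_ne_zero_iff, hx1]; exact one_ne_zero
  have h : radialExtension (zonalFun q p) =ᶠ[𝓝 (x : Ambient d)] Complex.ofRealCLM ∘
      (fun y : Ambient d => p.eval (⟪(q : Ambient d), y⟫ * ‖y‖⁻¹)) := by
    filter_upwards [isOpen_ne.mem_nhds hx0] with y hy
    have hy' : y ≠ 0 := hy
    simp [radialExtension, hy', zonalFun_apply, inner_smul_right, mul_comm]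
  have hcd : ContDiffAt ℝ 2
      (fun y : Ambient d => p.eval (⟪(q : Ambient d), y⟫ * ‖y‖⁻¹)) x := by
    have h1 : ContDiff ℝ 2 (fun t : ℝ => p.eval t) := by
      simpa using p.contDiff_aeval (𝕜 := ℝ) (n := 2)
    exact h1.contDiffAt.comp _ ((contDiffAt_const.inner ℝ contDiffAt_id).mul
      ((contDiffAt_norm ℝ hx0).inv (by simp)))
  rw [sphereLaplacian, (InnerProductSpace.laplacian_congr_nhds h).eq_of_nhds,
    hcd.laplacian_CLM_comp_left, Function.comp_apply, laplacian_zonal_polynomial, hp]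
  simp [zonalFun_apply]

/-! ### Symmetry of the spherical Laplacian -/

theorem integral_fderiv_eq_zero_of_hasCompactSupport {d : ℕ} {W : Ambient d → ℂ}
    (hW : ContDiff ℝ 1 W) (hc : HasCompactSupport W) (v : Ambient d) :
    ∫ y, fderiv ℝ W y v = 0 := by
  have hint : Integrable (fun y => fderiv ℝ W y v) :=
    ((hW.continuous_fderiv (by norm_num)).clm_apply continuous_const).integrable_of_hasCompactSupport
      (hc.fderiv_apply ℝ v)
  have h := integral_smul_fderiv_eq_neg_fderiv_smul_of_integrable (𝕜 := ℝ)
    (μ := (volume : Measure (Ambient d)))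
    (f := fun _ => (1 : ℝ)) (g := W) (v := v) (by simp) (by simpa using hint)
    (by simpa using hW.continuous.integrable_of_hasCompactSupport hc)
    (fun x _ => by fun_prop) (fun x _ => hW.differentiable (by norm_num) x)
  simpa using h

/-- The extension is homogeneous of degree 0, so its second derivatives are homogeneous of degree
-2. -/
theorem radialExtension_laplacian {d : ℕ} {u : Sph d → ℂ} (hu : ContMDiff (𝓡 d) 𝓘(ℝ, ℂ) ∞ u)
    {y : Ambient d} (hy : y ≠ 0) :
    Laplacian.laplacian (radialExtension u) y =
      -(((‖y‖ ^ 2)⁻¹ : ℝ) * radialExtension (sphereLaplacian u) y) := by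
  have hn : 0 < ‖y‖ := norm_pos_iff.2 hy
  set r := ‖y‖ with hr
  set x : Ambient d := r⁻¹ • y with hx
  have hyx : y = r • x := by rw [hx, smul_smul, mul_inv_cancel₀ hn.ne', one_smul]
  have hx0 : x ≠ 0 := smul_ne_zero (inv_ne_zero hn.ne') hy
  have h1 : ∀ z : Ambient d, ∀ e, fderiv ℝ (radialExtension u) z e =
      r * fderiv ℝ (radialExtension u) (r • z) e := by
    intro z e
    have h : (fun z => radialExtension u (r • z)) = radialExtension u := by
      ext z; exact radialExtension_smul u hn z
    have h2 := fderiv_comp_smul (𝕜 := ℝ) (f := radialExtension u) (x := z) r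
    rw [h] at h2
    rw [h2]
    simp
  have h2 : ∀ e, fderiv ℝ (fun z => fderiv ℝ (radialExtension u) z e) x e =
      r ^ 2 * fderiv ℝ (fun z => fderiv ℝ (radialExtension u) z e) y e := by
    intro e
    have hd : DifferentiableAt ℝ (fun z => fderiv ℝ (radialExtension u) z e) y :=
      (((contDiffAt_radialExtension hu hy).fderiv_right (m := 1)
        (by norm_cast)).differentiableAt (by norm_num)).clm_apply (by fun_prop)
    have h : (fun z => fderiv ℝ (radialExtension u) z e) =
        fun z => (r : ℂ) * fderiv ℝ (radialExtension u) (r • z) e := by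
      ext z; exact h1 z e
    have hd' : DifferentiableAt ℝ (fun z => fderiv ℝ (radialExtension u) (r • z) e) x := by
      rw [hyx] at hd
      exact hd.comp (f := fun z : Ambient d => r • z) x (by fun_prop)
    have h3 := fderiv_comp_smul (𝕜 := ℝ) (f := fun z => fderiv ℝ (radialExtension u) z e) (x := x) r
    rw [h, fderiv_const_mul hd', h3, ← hyx]
    rw [← h]
    simp
    ring
  have hS : radialExtension (sphereLaplacian u) y = -(Laplacian.laplacian (radialExtension u) x) := by
    rw [radialExtension, dif_pos hy]; rfl
  have hr2 : (r : ℂ) ≠ 0 := by exact_mod_cast hn.ne'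
  rw [hS, laplacian_eq_sum_fderiv ((contDiffAt_radialExtension hu hy).of_le (by norm_cast)),
    laplacian_eq_sum_fderiv ((contDiffAt_radialExtension hu hx0).of_le (by norm_cast))]
  simp only [h2, ← Finset.mul_sum]
  push_cast
  field_simp

/-- Integration in polar coordinates of a product. -/
theorem integral_mul_radialExtension {d : ℕ} (φ : ℝ → ℂ) (w : Sph d → ℂ) :
    ∫ y : Ambient d, φ ‖y‖ * radialExtension w y =
      (∫ x, w x ∂(surfaceMeasure d)) * ∫ r : Ioi (0 : ℝ), φ r ∂(Measure.volumeIoiPow d) := by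
  have hdim : Module.finrank ℝ (Ambient d) - 1 = d := by simp
  calc
    ∫ y : Ambient d, φ ‖y‖ * radialExtension w y
      = ∫ y : ({(0)}ᶜ : Set (Ambient d)), φ ‖y.1‖ * radialExtension w y.1
          ∂((volume : Measure (Ambient d)).comap (↑)) := by
      rw [integral_subtype_comap (measurableSet_singleton _).compl
        fun y : Ambient d => φ ‖y‖ * radialExtension w y, restrict_compl_singleton]
    _ = ∫ z, w z.1 * φ z.2 ∂((surfaceMeasure d).prod
          (Measure.volumeIoiPow (Module.finrank ℝ (Ambient d) - 1))) := by
      rw [← ((volume : Measure (Ambient d)).measurePreserving_homeomorphUnitSphereProd).integral_comp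
        (Homeomorph.measurableEmbedding _)]
      refine integral_congr_ae (Filter.Eventually.of_forall fun y => ?_)
      have hy : (y : Ambient d) ≠ 0 := y.2
      simp only [radialExtension, dif_pos hy, homeomorphUnitSphereProd_apply_snd_coe]
      rw [mul_comm]
      congr 2
      exact Subtype.ext (homeomorphUnitSphereProd_apply_fst_coe _ y).symm
    _ = _ := by
      rw [hdim, integral_prod_mul w (fun r : Ioi (0 : ℝ) => φ r)]

/-- There is a nonnegative, nonzero, smooth radial cutoff of compact support that vanishes near the
origin. -/
theorem exists_radial_cutoff :
    ∃ κ : ℝ → ℝ, ContDiff ℝ ∞ κ ∧ (∀ s, 0 ≤ κ s) ∧ κ 1 ≠ 0 ∧ (∀ s < 1 / 2, κ s = 0) ∧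
      ∀ s, 2 < s → κ s = 0 := by
  let ψ : ContDiffBump (1 : ℝ) := ⟨1 / 4, 1 / 2, by norm_num, by norm_num⟩
  refine ⟨ψ, ψ.contDiff, fun s => ψ.nonneg, ?_, fun s hs => ?_, fun s hs => ?_⟩
  · rw [ψ.one_of_mem_closedBall (by simp [ψ])]; exact one_ne_zero
  · apply ψ.zero_of_le_dist
    rw [Real.dist_eq, abs_sub_comm]
    exact (by linarith : (1 / 2 : ℝ) ≤ 1 - s).trans (le_abs_self _)
  · apply ψ.zero_of_le_dist
    rw [Real.dist_eq]
    exact (by linarith : (1 / 2 : ℝ) ≤ s - 1).trans (le_abs_self _)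

theorem contDiff_cutoff_mul {d : ℕ} {c : ℝ → ℝ} (hc : ContDiff ℝ ∞ c)
    (h0 : ∀ s < 1 / 2, c s = 0) {V : Ambient d → ℂ} (hV : ∀ y ≠ 0, ContDiffAt ℝ 1 V y) :
    ContDiff ℝ 1 (fun y => (c (‖y‖ ^ 2) : ℂ) * V y) := by
  rw [contDiff_iff_contDiffAt]
  intro y
  by_cases hy : y = 0
  · have : ∀ᶠ z in 𝓝 y, ‖z‖ ^ 2 < 1 / 2 := by
      have hcont : Continuous (fun y : Ambient d => ‖y‖ ^ 2) := by fun_prop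
      exact hcont.continuousAt.eventually_lt continuousAt_const (by simp [hy])
    refine (contDiffAt_const (c := (0 : ℂ))).congr_of_eventuallyEq ?_
    filter_upwards [this] with z hz
    simp [h0 _ hz]
  · have h1 : ContDiffAt ℝ 1 (fun y : Ambient d => c (‖y‖ ^ 2)) y :=
      ((hc.of_le (by norm_cast)).comp (contDiff_norm_sq ℝ)).contDiffAt
    exact (Complex.ofRealCLM.contDiff.contDiffAt.comp y h1).mul (hV y hy)

theorem hasCompactSupport_cutoff_mul {d : ℕ} {c : ℝ → ℝ} (h2 : ∀ s, 2 < s → c s = 0)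
    (V : Ambient d → ℂ) : HasCompactSupport (fun y => (c (‖y‖ ^ 2) : ℂ) * V y) := by
  refine HasCompactSupport.intro (isCompact_closedBall (0 : Ambient d) 2) fun y hy => ?_
  rw [mem_closedBall_zero_iff, not_le] at hy
  rw [h2 _ (by nlinarith)]
  simp

/-- The derivative of a radially constant function in the radial direction vanishes. -/
theorem fderiv_radialExtension_self {d : ℕ} {u : Sph d → ℂ} (hu : ContMDiff (𝓡 d) 𝓘(ℝ, ℂ) ∞ u)
    {y : Ambient d} (hy : y ≠ 0) : fderiv ℝ (radialExtension u) y y = 0 := by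
  have hd : DifferentiableAt ℝ (radialExtension u) ((1 : ℝ) • y) := by
    rw [one_smul]
    exact (contDiffAt_radialExtension hu hy).differentiableAt (by norm_num)
  have h1 : HasDerivAt (fun r : ℝ => r • y) ((1 : ℝ) • y) 1 := (hasDerivAt_id (1 : ℝ)).smul_const y
  have h2 := hd.hasFDerivAt.comp_hasDerivAt (1 : ℝ) h1
  have h3 : HasDerivAt (radialExtension u ∘ fun r : ℝ => r • y) 0 1 := by
    refine (hasDerivAt_const (1 : ℝ) (radialExtension u y)).congr_of_eventuallyEq ?_
    filter_upwards [lt_mem_nhds (zero_lt_one' ℝ)] with r hr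
    exact radialExtension_smul u hr y
  simpa using h2.unique h3

/-- The integrand is the divergence of the compactly supported field c(‖y‖²)(U∇V - V∇U): the
gradient of the cutoff is radial, and U and V have no radial derivative. -/
theorem integral_cutoff_mul_laplacian_sub {d : ℕ} {c : ℝ → ℝ} (hc : ContDiff ℝ ∞ c)
    (h0 : ∀ s < 1 / 2, c s = 0) (h2 : ∀ s, 2 < s → c s = 0) {u v : Sph d → ℂ}
    (hu : ContMDiff (𝓡 d) 𝓘(ℝ, ℂ) ∞ u) (hv : ContMDiff (𝓡 d) 𝓘(ℝ, ℂ) ∞ v) :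
    ∫ y : Ambient d, (c (‖y‖ ^ 2) : ℂ) *
      (radialExtension u y * Laplacian.laplacian (radialExtension v) y
        - radialExtension v y * Laplacian.laplacian (radialExtension u) y) = 0 := by
  set U := radialExtension u with hU
  set V := radialExtension v with hV
  set b := EuclideanSpace.basisFun (Fin (d + 1)) ℝ with hb
  let Y : Fin (d + 1) → Ambient d → ℂ := fun i y =>
    U y * fderiv ℝ V y (b i) - V y * fderiv ℝ U y (b i)
  have hdU : ∀ y ≠ 0, ∀ e, ContDiffAt ℝ 1 (fun z => fderiv ℝ U z e) y := fun y hy e =>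
    ((contDiffAt_radialExtension hu hy).fderiv_right (m := 1) (by norm_cast)).clm_apply
      contDiffAt_const
  have hdV : ∀ y ≠ 0, ∀ e, ContDiffAt ℝ 1 (fun z => fderiv ℝ V z e) y := fun y hy e =>
    ((contDiffAt_radialExtension hv hy).fderiv_right (m := 1) (by norm_cast)).clm_apply
      contDiffAt_const
  have hU1 : ∀ y ≠ 0, ContDiffAt ℝ 1 U y := fun y hy =>
    (contDiffAt_radialExtension hu hy).of_le (by norm_cast)
  have hV1 : ∀ y ≠ 0, ContDiffAt ℝ 1 V y := fun y hy =>
    (contDiffAt_radialExtension hv hy).of_le (by norm_cast)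
  have hY : ∀ i, ∀ y ≠ 0, ContDiffAt ℝ 1 (Y i) y := fun i y hy =>
    ((hU1 y hy).mul (hdV y hy _)).sub ((hV1 y hy).mul (hdU y hy _))
  have hW : ∀ i, ContDiff ℝ 1 (fun y => (c (‖y‖ ^ 2) : ℂ) * Y i y) := fun i =>
    contDiff_cutoff_mul hc h0 (hY i)
  have hWc : ∀ i, HasCompactSupport (fun y => (c (‖y‖ ^ 2) : ℂ) * Y i y) := fun i =>
    hasCompactSupport_cutoff_mul h2 (Y i)
  have hpt : ∀ y : Ambient d, (c (‖y‖ ^ 2) : ℂ) *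
      (U y * Laplacian.laplacian V y - V y * Laplacian.laplacian U y) =
      ∑ i, fderiv ℝ (fun y => (c (‖y‖ ^ 2) : ℂ) * Y i y) y (b i) := by
    intro y
    by_cases hy : y = 0
    · have hcont : Continuous (fun y : Ambient d => ‖y‖ ^ 2) := by fun_prop
      have hnear : ∀ᶠ z in 𝓝 y, ‖z‖ ^ 2 < 1 / 2 :=
        hcont.continuousAt.eventually_lt continuousAt_const (by simp [hy])
      have hz : ∀ i, (fun y => (c (‖y‖ ^ 2) : ℂ) * Y i y) =ᶠ[𝓝 y] fun _ => 0 := fun i => by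
        filter_upwards [hnear] with z hz
        simp [h0 _ hz]
      rw [h0 _ hnear.self_of_nhds, Complex.ofReal_zero, zero_mul]
      exact (Finset.sum_eq_zero fun i _ => by rw [(hz i).fderiv_eq]; simp).symm
    · have hcd : HasFDerivAt (fun y : Ambient d => (c (‖y‖ ^ 2) : ℂ))
          (Complex.ofRealCLM.comp (deriv c (‖y‖ ^ 2) • (2 • innerSL ℝ y))) y := by
        have h1 : HasFDerivAt (fun y : Ambient d => ‖y‖ ^ 2) (2 • innerSL ℝ y) y :=
          (hasStrictFDerivAt_norm_sq y).hasFDerivAt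
        have h3 := ((hc.differentiable (by norm_num)) (‖y‖ ^ 2)).hasDerivAt.comp_hasFDerivAt y h1
        exact Complex.ofRealCLM.hasFDerivAt.comp y h3
      have hd : ∀ i, fderiv ℝ (fun y => (c (‖y‖ ^ 2) : ℂ) * Y i y) y (b i) =
          (c (‖y‖ ^ 2) : ℂ) * (U y * fderiv ℝ (fun z => fderiv ℝ V z (b i)) y (b i)
            - V y * fderiv ℝ (fun z => fderiv ℝ U z (b i)) y (b i))
          + (2 * deriv c (‖y‖ ^ 2) : ℂ) * (U y * (⟪b i, y⟫ • fderiv ℝ V y (b i))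
            - V y * (⟪b i, y⟫ • fderiv ℝ U y (b i))) := by
        intro i
        have hU2 := ((hU1 y hy).differentiableAt (by norm_num)).hasFDerivAt
        have hV2 := ((hV1 y hy).differentiableAt (by norm_num)).hasFDerivAt
        have hU3 := ((hdU y hy (b i)).differentiableAt (by norm_num)).hasFDerivAt
        have hV3 := ((hdV y hy (b i)).differentiableAt (by norm_num)).hasFDerivAt
        have h := (hcd.mul ((hU2.mul hV3).sub (hV2.mul hU3))).fderiv
        change fderiv ℝ (fun y => (c (‖y‖ ^ 2) : ℂ) * Y i y) y = _ at h
        rw [h]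
        simp [real_inner_comm, -EuclideanSpace.basisFun_inner, -EuclideanSpace.inner_basisFun_real]
        ring
      have hsum : ∀ L : Ambient d →L[ℝ] ℂ, ∑ i, ⟪b i, y⟫ • L (b i) = L y := fun L => by
        conv_rhs => rw [← b.sum_repr' y]
        simp only [map_sum, map_smul]
      rw [Finset.sum_congr rfl fun i _ => hd i, Finset.sum_add_distrib, ← Finset.mul_sum,
        ← Finset.mul_sum, Finset.sum_sub_distrib, Finset.sum_sub_distrib, ← Finset.mul_sum,
        ← Finset.mul_sum, ← Finset.mul_sum, ← Finset.mul_sum, hsum, hsum,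
        fderiv_radialExtension_self hu hy, fderiv_radialExtension_self hv hy,
        laplacian_eq_sum_fderiv ((contDiffAt_radialExtension hu hy).of_le (by norm_cast)),
        laplacian_eq_sum_fderiv ((contDiffAt_radialExtension hv hy).of_le (by norm_cast))]
      simp only [mul_zero, sub_zero, add_zero]
      rfl
  simp only [hpt]
  rw [integral_finsetSum]
  · exact Finset.sum_eq_zero fun i _ =>
      integral_fderiv_eq_zero_of_hasCompactSupport (hW i) (hWc i) _
  · intro i _
    exact (((hW i).continuous_fderiv (by norm_num)).clm_apply
      continuous_const).integrable_of_hasCompactSupport ((hWc i).fderiv_apply ℝ _)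

/-- The spherical Laplacian is symmetric. -/
theorem integral_mul_sphereLaplacian_sub {d : ℕ} {u v : Sph d → ℂ}
    (hu : ContMDiff (𝓡 d) 𝓘(ℝ, ℂ) ∞ u) (hv : ContMDiff (𝓡 d) 𝓘(ℝ, ℂ) ∞ v) :
    ∫ x, (u x * sphereLaplacian v x - v x * sphereLaplacian u x) ∂(surfaceMeasure d) = 0 := by
  obtain ⟨κ, hκ, hnn, hne, h0, h2⟩ := exists_radial_cutoff
  -- The extra factor s = ‖y‖² cancels the ‖y‖⁻² of `radialExtension_laplacian`, so that the
  -- integrand splits in polar coordinates.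
  have hg := integral_cutoff_mul_laplacian_sub (c := fun s => s * κ s) (contDiff_id.mul hκ)
    (fun s hs => by simp [h0 s hs]) (fun s hs => by simp [h2 s hs]) hu hv
  have hpt : ∀ᵐ y : Ambient d, (((fun s => s * κ s) (‖y‖ ^ 2) : ℝ) : ℂ) *
      (radialExtension u y * Laplacian.laplacian (radialExtension v) y
        - radialExtension v y * Laplacian.laplacian (radialExtension u) y) =
      (-κ (‖y‖ ^ 2) : ℂ) *
        radialExtension (fun x => u x * sphereLaplacian v x - v x * sphereLaplacian u x) y := by
    filter_upwards [compl_mem_ae_iff.2 (measure_singleton (0 : Ambient d))] with y hy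
    have hy' : y ≠ 0 := hy
    have hn : (‖y‖ : ℂ) ≠ 0 := by exact_mod_cast norm_ne_zero_iff.2 hy'
    rw [radialExtension_laplacian hu hy', radialExtension_laplacian hv hy']
    simp only [radialExtension, dif_pos hy']
    push_cast
    field_simp
    ring
  rw [integral_congr_ae hpt, integral_mul_radialExtension (fun r => (-κ (r ^ 2) : ℂ))] at hg
  refine (mul_eq_zero.1 hg).resolve_right fun hK => ?_
  -- If the radial factor were zero, the same formula with angular part 1 would make the integral of
  -- κ(‖y‖²) vanish.
  have h1 := integral_mul_radialExtension (d := d) (fun r => (-κ (r ^ 2) : ℂ)) (fun _ => 1)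
  rw [hK, mul_zero] at h1
  have hpos : 0 < ∫ y : Ambient d, κ (‖y‖ ^ 2) := by
    refine Continuous.integral_pos_of_hasCompactSupport_nonneg_nonzero
      (x := EuclideanSpace.single 0 1) (hκ.continuous.comp (by fun_prop)) ?_ (fun y => hnn _)
      (by simpa using hne)
    refine HasCompactSupport.intro (isCompact_closedBall (0 : Ambient d) 2) fun y hy => ?_
    rw [mem_closedBall_zero_iff, not_le] at hy
    exact h2 _ (by nlinarith)
  have hae : ∀ᵐ y : Ambient d, (-κ (‖y‖ ^ 2) : ℂ) * radialExtension (fun _ : Sph d => 1) y =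
      ((-κ (‖y‖ ^ 2) : ℝ) : ℂ) := by
    filter_upwards [compl_mem_ae_iff.2 (measure_singleton (0 : Ambient d))] with y hy
    have hy' : y ≠ 0 := hy
    simp [radialExtension, hy']
  rw [integral_congr_ae hae, integral_complex_ofReal, integral_neg] at h1
  have h3 : -∫ y : Ambient d, κ (‖y‖ ^ 2) = 0 := by exact_mod_cast h1
  linarith

theorem integrable_of_continuous_sph {d : ℕ} {E : Type*} [NormedAddCommGroup E] {f : Sph d → E}
    (hf : Continuous f) :
    Integrable f (surfaceMeasure d) :=
  hf.integrable_of_hasCompactSupport (HasCompactSupport.of_compactSpace f)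

/-- Eigenfunctions of different energies are orthogonal. -/
theorem integral_mul_eq_zero_of_mem_laplaceKer {d : ℕ} {μ ν : ℝ} (hne : μ ≠ ν) {u v : C(Sph d, ℂ)}
    (hu : u ∈ laplaceKer d μ) (hv : v ∈ laplaceKer d ν) :
    ∫ x, u x * v x ∂(surfaceMeasure d) = 0 := by
  have h := integral_mul_sphereLaplacian_sub hu.1 hv.1
  simp only [hu.2, hv.2] at h
  have h1 : ∀ x, u x * (ν * v x) - v x * (μ * u x) = ((ν : ℂ) - μ) * (u x * v x) := fun x => by ring
  simp only [h1] at h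
  rw [integral_const_mul] at h
  refine (mul_eq_zero.1 h).resolve_left ?_
  rw [sub_eq_zero]
  exact_mod_cast hne.symm

theorem lamSq_injective {d : ℕ} (hd : 0 < d) : Function.Injective (lamSq d) := by
  have h1 : (1 : ℝ) ≤ d := by exact_mod_cast hd
  have hlt : ∀ m n : ℕ, m < n → lamSq d m < lamSq d n := fun m n h => by
    have h2 : (m : ℝ) < n := by exact_mod_cast h
    have h3 : (0 : ℝ) ≤ m := m.cast_nonneg
    unfold lamSq
    nlinarith [mul_nonneg h3 (sub_nonneg.2 h1)]
  exact (strictMono_nat_of_lt_succ fun n => hlt n (n + 1) n.lt_succ_self).injective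

/-! ### Identification of the zonal harmonics -/

/-- Integration of a zonal function against a continuous function. -/
def zonalPairing {d : ℕ} (q : Sph d) (u : C(Sph d, ℂ)) : Polynomial ℝ →ₗ[ℝ] ℂ where
  toFun p := ∫ x, zonalFun q p x * u x ∂(surfaceMeasure d)
  map_add' p r := by
    rw [← integral_add (integrable_of_continuous_sph (by fun_prop))
      (integrable_of_continuous_sph (by fun_prop))]
    simp [zonalFun_apply, add_mul]
  map_smul' a p := by
    rw [RingHom.id_apply, Complex.real_smul, ← integral_const_mul]
    simp [zonalFun_apply, mul_assoc]

theorem zonalPairing_apply {d : ℕ} (q : Sph d) (u : C(Sph d, ℂ)) (p : Polynomial ℝ) :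
    zonalPairing q u p = ∫ x, zonalFun q p x * u x ∂(surfaceMeasure d) := rfl

/-- Integration of a real zonal function over the sphere. -/
def zonalIntegral {d : ℕ} (q : Sph d) : Polynomial ℝ →ₗ[ℝ] ℝ where
  toFun p := ∫ x : Sph d, p.eval ⟪(q : Ambient d), (x : Ambient d)⟫ ∂(surfaceMeasure d)
  map_add' p r := by
    rw [← integral_add (integrable_of_continuous_sph (by fun_prop))
      (integrable_of_continuous_sph (by fun_prop))]
    simp
  map_smul' a p := by
    rw [RingHom.id_apply, smul_eq_mul, ← integral_const_mul]
    simp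

theorem zonalIntegral_apply {d : ℕ} (q : Sph d) (p : Polynomial ℝ) : zonalIntegral q p =
    ∫ x : Sph d, p.eval ⟪(q : Ambient d), (x : Ambient d)⟫ ∂(surfaceMeasure d) := rfl

theorem zonalPairing_zonalFun {d : ℕ} (q : Sph d) (p r : Polynomial ℝ) :
    zonalPairing q (zonalFun q r) p = (zonalIntegral q (p * r) : ℂ) := by
  rw [zonalPairing_apply, zonalIntegral_apply, ← integral_complex_ofReal]
  simp [zonalFun_apply]

theorem zonalFun_C_mul_gegen_mem_laplaceKer {d : ℕ} (hd : 0 < d) (q : Sph d) (a : ℝ) (n : ℕ) :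
    zonalFun q (Polynomial.C a * gegen d n) ∈ laplaceKer d (lamSq d n) := by
  apply zonalFun_mem_laplaceKer
  have := gegen_ode d hd n
  simp only [Polynomial.derivative_C_mul]
  linear_combination Polynomial.C a * this

theorem zonalFun_gegen_mem_laplaceKer {d : ℕ} (hd : 0 < d) (q : Sph d) (n : ℕ) :
    zonalFun q (gegen d n) ∈ laplaceKer d (lamSq d n) :=
  zonalFun_mem_laplaceKer q (gegen_ode d hd n)

theorem zonalPairing_gegen_eq_zero {d : ℕ} (hd : 0 < d) (q : Sph d) {m n : ℕ} (hmn : m ≠ n)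
    {u : C(Sph d, ℂ)} (hu : u ∈ laplaceKer d (lamSq d n)) : zonalPairing q u (gegen d m) = 0 :=
  integral_mul_eq_zero_of_mem_laplaceKer (fun h => hmn (lamSq_injective hd h))
    (zonalFun_gegen_mem_laplaceKer hd q m) hu

/-- The squared norm of the zonal function of a Gegenbauer polynomial. -/
def gegenNormSq {d : ℕ} (q : Sph d) (n : ℕ) : ℝ := zonalIntegral q (gegen d n * gegen d n)

theorem zonalIntegral_gegen_mul {d : ℕ} (hd : 0 < d) (q : Sph d) {m n : ℕ} (hmn : m ≠ n) :
    zonalIntegral q (gegen d m * gegen d n) = 0 := by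
  have h := zonalPairing_gegen_eq_zero hd q hmn (zonalFun_gegen_mem_laplaceKer hd q n)
  rw [zonalPairing_zonalFun] at h
  exact_mod_cast h

theorem gegenNormSq_pos {d : ℕ} (hd : 0 < d) (q : Sph d) (n : ℕ) : 0 < gegenNormSq q n := by
  have hq1 : ‖(q : Ambient d)‖ = 1 := by simp
  rw [gegenNormSq, zonalIntegral_apply]
  refine Continuous.integral_pos_of_hasCompactSupport_nonneg_nonzero (x := q) (by fun_prop)
    (HasCompactSupport.of_compactSpace _) (fun x => ?_) ?_
  · simpa using mul_self_nonneg _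
  · simp [hq1, gegen_eval_one d hd]

/-- The zonal functions of Gegenbauer polynomials have the reproducing property. -/
theorem zonalPairing_gegen_self {d : ℕ} (hd : 0 < d) (q : Sph d) (n : ℕ) {u : C(Sph d, ℂ)}
    (hu : u ∈ laplaceKer d (lamSq d n)) :
    zonalPairing q u (gegen d n) = gegenNormSq q n * u q := by
  have hq1 : ‖(q : Ambient d)‖ = 1 := by simp
  -- Both pairings vanish on P_m for m ≠ n, and the coefficients are chosen so that Φ also vanishes
  -- on P_n.
  let Φ : Polynomial ℝ →ₗ[ℝ] ℂ := (gegenNormSq q n : ℂ) • zonalPairing q u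
    - (zonalPairing q u (gegen d n)) • zonalPairing q (zonalFun q (gegen d n))
  have hΦ : Φ = 0 := by
    refine linearMap_eq_zero_of_gegen hd Φ fun m => ?_
    by_cases hmn : m = n
    · subst hmn
      simp only [Φ, LinearMap.sub_apply, LinearMap.smul_apply, zonalPairing_zonalFun, smul_eq_mul,
        gegenNormSq]
      ring
    · simp [Φ, zonalPairing_gegen_eq_zero hd q hmn hu,
        zonalPairing_gegen_eq_zero hd q hmn (zonalFun_gegen_mem_laplaceKer hd q n)]
  -- The normalized powers of c are zonal polynomials that concentrate at q, its unique maximum.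
  -- Testing Φ = 0 on them turns each pairing into the value at q, where P_n is 1.
  let c : Sph d → ℝ := fun x => (1 + ⟪(q : Ambient d), (x : Ambient d)⟫) / 2
  have hc : Continuous c := by fun_prop
  have hcq : c q = 1 := by simp [c, hq1]
  have hpeak : ∀ w : C(Sph d, ℂ), Filter.Tendsto (fun k : ℕ =>
      (∫ x, c x ^ k ∂(surfaceMeasure d))⁻¹ •
        zonalPairing q w ((Polynomial.C (1 / 2) * (1 + Polynomial.X)) ^ k)) Filter.atTop
      (𝓝 (w q)) := by
    intro w
    have h := tendsto_setIntegral_pow_smul_of_unique_maximum_of_isCompact_of_continuousOn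
      (μ := surfaceMeasure d) (s := univ) (x₀ := q) (g := w) isCompact_univ (c := c)
      hc.continuousOn ?_ ?_ (by rw [hcq]; exact one_pos) (by simp) w.continuous.continuousOn
    · simp only [Measure.restrict_univ] at h
      refine h.congr fun k => ?_
      rw [zonalPairing_apply]
      congr 2
      ext x
      rw [Complex.real_smul, zonalFun_apply]
      congr 2
      simp [c]
      ring
    · intro y _ hy
      have h1 : ⟪(q : Ambient d), (y : Ambient d)⟫ < 1 := by
        refine lt_of_le_of_ne ?_ fun h => hy ?_
        · simpa [hq1] using real_inner_le_norm (q : Ambient d) (y : Ambient d)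
        · exact ((sphere_ext_iff q y).2 h).symm
      rw [hcq]
      simp only [c]
      linarith
    · intro y _
      have h1 := neg_le_of_abs_le (abs_real_inner_le_norm (q : Ambient d) (y : Ambient d))
      simp only [norm_eq_of_mem_sphere, mul_one] at h1
      simp only [c]
      linarith
  have h1 := ((hpeak u).const_mul (gegenNormSq q n : ℂ)).sub
    ((hpeak (zonalFun q (gegen d n))).const_mul (zonalPairing q u (gegen d n)))
  have h2 : ∀ k : ℕ, (gegenNormSq q n : ℂ) * ((∫ x, c x ^ k ∂(surfaceMeasure d))⁻¹ •
        zonalPairing q u ((Polynomial.C (1 / 2) * (1 + Polynomial.X)) ^ k)) -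
      zonalPairing q u (gegen d n) * ((∫ x, c x ^ k ∂(surfaceMeasure d))⁻¹ •
        zonalPairing q (zonalFun q (gegen d n))
          ((Polynomial.C (1 / 2) * (1 + Polynomial.X)) ^ k)) = 0 := by
    intro k
    have h3 := LinearMap.congr_fun hΦ ((Polynomial.C (1 / 2) * (1 + Polynomial.X)) ^ k)
    simp only [Φ, LinearMap.sub_apply, LinearMap.smul_apply, smul_eq_mul,
      LinearMap.zero_apply] at h3
    rw [Complex.real_smul, Complex.real_smul]
    linear_combination (((∫ x, c x ^ k ∂(surfaceMeasure d))⁻¹ : ℝ) : ℂ) * h3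
  simp only [h2] at h1
  have h4 := tendsto_nhds_unique h1 tendsto_const_nhds
  rw [sub_eq_zero, zonalFun_apply, real_inner_self_eq_norm_sq, hq1, one_pow,
    gegen_eval_one d hd, Complex.ofReal_one, mul_one] at h4
  exact h4.symm

theorem inner_toL2_zonalFun {d : ℕ} (q : Sph d) (p : Polynomial ℝ) (u : C(Sph d, ℂ)) :
    inner ℂ (toL2 (zonalFun q p)) (toL2 u) = zonalPairing q u p := by
  rw [ContinuousMap.inner_toLp, zonalPairing_apply]
  refine integral_congr_ae (Filter.Eventually.of_forall fun x => ?_)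
  simp [zonalFun_apply, mul_comm]

theorem norm_toL2_zonalFun_sq {d : ℕ} (q : Sph d) (n : ℕ) :
    ‖toL2 (zonalFun q (gegen d n))‖ ^ 2 = gegenNormSq q n := by
  have h := inner_toL2_zonalFun q (gegen d n) (zonalFun q (gegen d n))
  rw [zonalPairing_zonalFun, inner_self_eq_norm_sq_to_K] at h
  exact Complex.ofReal_injective (by rw [Complex.ofReal_pow]; exact h)

theorem inner_toL2_zonalFun_eq_zero {d : ℕ} (hd : 0 < d) (q : Sph d) {m n : ℕ} (hmn : m ≠ n) :
    inner ℂ (toL2 (zonalFun q (gegen d m))) (toL2 (zonalFun q (gegen d n))) = 0 := by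
  rw [inner_toL2_zonalFun]
  exact zonalPairing_gegen_eq_zero hd q hmn (zonalFun_gegen_mem_laplaceKer hd q n)

theorem isZonalHarmonic_zonalFun {d : ℕ} (hd : 0 < d) (q : Sph d) (n : ℕ) :
    IsZonalHarmonic n q (zonalFun q (Polynomial.C (gegenNormSq q n)⁻¹ * gegen d n)) := by
  refine ⟨zonalFun_C_mul_gegen_mem_laplaceKer hd q _ n, fun u hu => ?_⟩
  rw [inner_toL2_zonalFun, ← Polynomial.smul_eq_C_mul, map_smul, zonalPairing_gegen_self hd q n hu,
    Complex.real_smul, ← mul_assoc, ← Complex.ofReal_mul,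
    inv_mul_cancel₀ (gegenNormSq_pos hd q n).ne', Complex.ofReal_one, one_mul]

/-- `zonalHarmonic` is an unspecified choice; this uniqueness, obtained by testing both candidates
on each other, lets the explicit one replace it. -/
theorem IsZonalHarmonic.toL2_eq {d ℓ : ℕ} {q : Sph d} {Z Z' : C(Sph d, ℂ)}
    (hZ : IsZonalHarmonic ℓ q Z) (hZ' : IsZonalHarmonic ℓ q Z') : toL2 Z = toL2 Z' := by
  rw [← sub_eq_zero, ← inner_self_eq_zero (𝕜 := ℂ), inner_sub_left, inner_sub_right,
    inner_sub_right, hZ.2 _ hZ.1, hZ.2 _ hZ'.1, hZ'.2 _ hZ.1, hZ'.2 _ hZ'.1, sub_self]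

theorem zonalL2_eq {d : ℕ} (hd : 0 < d) (ℓ : ℕ) (q : Sph d) :
    zonalL2 ℓ q = (((gegenNormSq q ℓ)⁻¹ : ℝ) : ℂ) • toL2 (zonalFun q (gegen d ℓ)) := by
  have h := isZonalHarmonic_zonalFun hd q ℓ
  have hex : ∃ Z : C(Sph d, ℂ), IsZonalHarmonic ℓ q Z := ⟨_, h⟩
  rw [zonalL2, zonalHarmonic, dif_pos hex, IsZonalHarmonic.toL2_eq hex.choose_spec h, ← map_smul]
  congr 1
  ext x
  simp [zonalFun_apply]

theorem norm_zonalL2_sq {d : ℕ} (hd : 0 < d) (ℓ : ℕ) (q : Sph d) :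
    ‖zonalL2 ℓ q‖ ^ 2 = (gegenNormSq q ℓ)⁻¹ := by
  have h := gegenNormSq_pos hd q ℓ
  rw [zonalL2_eq hd, norm_smul, mul_pow, norm_toL2_zonalFun_sq, Complex.norm_real, Real.norm_eq_abs,
    sq_abs]
  field_simp

theorem norm_zonalL2_pos {d : ℕ} (hd : 0 < d) (ℓ : ℕ) (q : Sph d) : 0 < ‖zonalL2 ℓ q‖ := by
  have h := inv_pos.2 (gegenNormSq_pos hd q ℓ)
  rw [← norm_zonalL2_sq hd ℓ q] at h
  exact lt_of_le_of_ne (norm_nonneg _) fun h0 => by simp [← h0] at h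

theorem orthonormal_normZonal {d : ℕ} (hd : 0 < d) (q : Sph d) :
    Orthonormal ℂ (fun ℓ => normZonal ℓ q) := by
  refine ⟨fun ℓ => ?_, fun m n hmn => ?_⟩
  · have h := norm_zonalL2_pos hd ℓ q
    change ‖((‖zonalL2 ℓ q‖⁻¹ : ℝ) : ℂ) • zonalL2 ℓ q‖ = 1
    rw [norm_smul, Complex.norm_real, Real.norm_eq_abs, abs_of_pos (inv_pos.2 h),
      inv_mul_cancel₀ h.ne']
  · simp only [normZonal]
    rw [inner_smul_left, inner_smul_right, zonalL2_eq hd m, zonalL2_eq hd n, inner_smul_left,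
      inner_smul_right, inner_toL2_zonalFun_eq_zero hd q hmn]
    simp

theorem zonalL2_eq_norm_smul_normZonal {d : ℕ} (hd : 0 < d) (ℓ : ℕ) (q : Sph d) :
    zonalL2 ℓ q = (‖zonalL2 ℓ q‖ : ℂ) • normZonal ℓ q := by
  have h := norm_zonalL2_pos hd ℓ q
  rw [normZonal, smul_smul, ← Complex.ofReal_mul, mul_inv_cancel₀ h.ne', Complex.ofReal_one,
    one_smul]

theorem zonalFun_neg {d : ℕ} (q : Sph d) (n : ℕ) :
    zonalFun (-q) (gegen d n) = (-1 : ℂ) ^ n • zonalFun q (gegen d n) := by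
  ext x
  simp [zonalFun_apply, gegen_eval_neg]

theorem zonalL2_neg {d : ℕ} (hd : 0 < d) (ℓ : ℕ) (q : Sph d) :
    zonalL2 ℓ (-q) = (-1 : ℂ) ^ ℓ • zonalL2 ℓ q := by
  have hs : toL2 (zonalFun (-q) (gegen d ℓ)) = (-1 : ℂ) ^ ℓ • toL2 (zonalFun q (gegen d ℓ)) := by
    rw [zonalFun_neg]
    exact map_smul (ContinuousMap.toLp 2 (surfaceMeasure d) ℂ) _ _
  have h : gegenNormSq (-q) ℓ = gegenNormSq q ℓ := by
    rw [← norm_toL2_zonalFun_sq, ← norm_toL2_zonalFun_sq, hs, norm_smul]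
    simp
  rw [zonalL2_eq hd, zonalL2_eq hd, h, hs, smul_comm]

/-! ### Norms of the zonal harmonics -/

/-- Two consecutive recurrences, integrated against P_{n+2} and P_{n+1}, contain the same mixed
integral of t P_{n+1} P_{n+2}; orthogonality removes one term from each, and the mixed integral is
eliminated. -/
theorem gegenNormSq_recurrence {d : ℕ} (hd : 0 < d) (q : Sph d) (n : ℕ) :
    ((n : ℝ) + d) * (2 * n + d + 3) * gegenNormSq q (n + 2) =
      (2 * n + d + 1) * (n + 2) * gegenNormSq q (n + 1) := by
  have h1 := congrArg (fun p => zonalIntegral q (p * gegen d (n + 2))) (gegen_recurrence d hd n)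
  have h2 := congrArg (fun p => zonalIntegral q (p * gegen d (n + 1))) (gegen_recurrence d hd (n + 1))
  simp only [sub_mul, mul_assoc, ← Polynomial.smul_eq_C_mul, map_sub, map_smul, smul_eq_mul,
    smul_mul_assoc] at h1 h2
  rw [zonalIntegral_gegen_mul hd q (by omega : n ≠ n + 2)] at h1
  rw [zonalIntegral_gegen_mul hd q (by omega : n + 1 + 2 ≠ n + 1),
    mul_comm (gegen d (n + 1 + 1))] at h2
  simp only [gegenNormSq]
  push_cast at h2
  have h3 : gegen d (n + 1 + 1) = gegen d (n + 2) := rfl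
  rw [h3] at h2
  linear_combination (2 * (n : ℝ) + d + 3) * h1 - (2 * (n : ℝ) + d + 1) * h2

/-- `gegenNormSq_recurrence` only links indices from 1 on; this supplies the link from 0 to 1. -/
theorem gegenNormSq_one {d : ℕ} (hd : 0 < d) (q : Sph d) :
    ((d : ℝ) + 1) * gegenNormSq q 1 = gegenNormSq q 0 := by
  have h1 := congrArg (fun p => zonalIntegral q (p * gegen d 0)) (gegen_recurrence d hd 0)
  simp only [sub_mul, mul_assoc, ← Polynomial.smul_eq_C_mul, map_sub, map_smul, smul_eq_mul,
    smul_mul_assoc] at h1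
  rw [zonalIntegral_gegen_mul hd q (by omega : 0 + 2 ≠ 0)] at h1
  have h3 : Polynomial.X * (gegen d (0 + 1) * gegen d 0) = gegen d 1 * gegen d 1 := by
    simp [gegen]
  rw [h3] at h1
  simp only [gegenNormSq]
  push_cast at h1
  linear_combination -h1

theorem gegenNormSq_two (q : Sph 2) (n : ℕ) :
    (2 * (n : ℝ) + 1) * gegenNormSq q n = gegenNormSq q 0 := by
  induction n with
  | zero => simp
  | succ n ih =>
    rcases n with _ | n
    · have := gegenNormSq_one two_pos q
      push_cast at this ⊢
      linarith
    · have h := gegenNormSq_recurrence two_pos q n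
      push_cast at h ih ⊢
      rw [← ih]
      have h2 : ((n : ℝ) + 2) ≠ 0 := by positivity
      apply mul_left_cancel₀ h2
      linear_combination h

theorem gegenNormSq_three (q : Sph 3) (n : ℕ) :
    ((n : ℝ) + 1) ^ 2 * gegenNormSq q n = gegenNormSq q 0 := by
  induction n with
  | zero => simp
  | succ n ih =>
    rcases n with _ | n
    · have := gegenNormSq_one three_pos q
      push_cast at this ⊢
      linarith
    · have h := gegenNormSq_recurrence three_pos q n
      push_cast at h ih ⊢
      rw [← ih]
      linear_combination h / 2

/-! ### Orthonormal series and normalization -/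

section Hilbert

variable {E : Type*} [NormedAddCommGroup E] [InnerProductSpace ℂ E]

theorem Orthonormal.norm_sum_smul_sq {ι : Type*} {z : ι → E} (hz : Orthonormal ℂ z) (c : ι → ℂ)
    (s : Finset ι) : ‖∑ i ∈ s, c i • z i‖ ^ 2 = ∑ i ∈ s, ‖c i‖ ^ 2 := by
  have h := hz.inner_sum c c s
  rw [inner_self_eq_norm_sq_to_K] at h
  apply Complex.ofReal_injective
  rw [Complex.ofReal_pow, Complex.ofReal_sum]
  refine Eq.trans h (Finset.sum_congr rfl fun i _ => ?_)
  rw [Complex.conj_mul', Complex.ofReal_pow]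

theorem Orthonormal.summable_smul_iff [CompleteSpace E] {z : ℕ → E} (hz : Orthonormal ℂ z)
    {c : ℕ → ℂ} : (Summable fun i => c i • z i) ↔ Summable fun i => ‖c i‖ ^ 2 := by
  simpa using hz.orthogonalFamily.summable_iff_norm_sq_summable c

theorem Orthonormal.hasSum_norm_sq [CompleteSpace E] {z : ℕ → E} (hz : Orthonormal ℂ z)
    {c : ℕ → ℂ} (hc : Summable fun i => ‖c i‖ ^ 2) :
    HasSum (fun i => ‖c i‖ ^ 2) (‖∑' i, c i • z i‖ ^ 2) := by
  have h := ((hz.summable_smul_iff.2 hc).hasSum.norm).pow 2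
  simp only [hz.norm_sum_smul_sq] at h
  exact h

/-- The difference is (C - ‖x‖) / (C ‖x‖) • x + (x - y) / C, whose first term has norm |C - ‖x‖| /
C. Here C need not be ‖y‖: in the application y is a truncated sum and C the norm of the full one.
-/
theorem norm_normalize_sub_le {x y : E} (hx : x ≠ 0) {C : ℝ} (hC : 0 < C) :
    ‖((‖x‖⁻¹ : ℝ) : ℂ) • x - (1 / (C : ℂ)) • y‖ ≤ (2 * ‖x - y‖ + |C - ‖y‖|) / C := by
  have hxn : 0 < ‖x‖ := norm_pos_iff.2 hx
  have h1 : ((‖x‖⁻¹ : ℝ) : ℂ) • x - (1 / (C : ℂ)) • y =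
      (((C - ‖x‖) / (C * ‖x‖) : ℝ) : ℂ) • x + ((C⁻¹ : ℝ) : ℂ) • (x - y) := by
    have hC' : (C : ℂ) ≠ 0 := by exact_mod_cast hC.ne'
    have hx' : (‖x‖ : ℂ) ≠ 0 := by exact_mod_cast hxn.ne'
    rw [smul_sub, add_sub_assoc', ← add_smul]
    congr 2
    · push_cast; field_simp; ring
    · push_cast; rw [one_div]
  have h2 : ‖(((C - ‖x‖) / (C * ‖x‖) : ℝ) : ℂ) • x‖ = |C - ‖x‖| / C := by
    rw [norm_smul, Complex.norm_real, Real.norm_eq_abs, abs_div, abs_of_pos (mul_pos hC hxn)]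
    field_simp
  have h3 : ‖((C⁻¹ : ℝ) : ℂ) • (x - y)‖ = ‖x - y‖ / C := by
    rw [norm_smul, Complex.norm_real, Real.norm_eq_abs, abs_of_pos (inv_pos.2 hC)]
    field_simp
  have h4 : |C - ‖x‖| ≤ |C - ‖y‖| + ‖x - y‖ := by
    have := abs_norm_sub_norm_le y x
    rw [norm_sub_rev] at this
    calc |C - ‖x‖| = |(C - ‖y‖) + (‖y‖ - ‖x‖)| := by ring_nf
      _ ≤ _ := (abs_add_le _ _).trans (by gcongr)
  rw [h1]
  refine (norm_add_le _ _).trans ?_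
  rw [h2, h3, ← add_div, div_le_div_iff_of_pos_right hC]
  linarith

end Hilbert

/-! ### Tail sums over the integers, and amplitudes -/

/-- The weight `(|k| + 1)⁻²` on the integers. -/
def intWeight (k : ℤ) : ℝ := ((|(k : ℝ)| + 1) ^ 2)⁻¹

theorem intWeight_nonneg (k : ℤ) : 0 ≤ intWeight k := by unfold intWeight; positivity

theorem sum_range_tail_le {m : ℕ} (hm : 1 ≤ m) (N : ℕ) :
    ∑ n ∈ Finset.range N, (if n ≤ m then 0 else (((n : ℝ) + 1) ^ 2)⁻¹) ≤ (m : ℝ)⁻¹ := by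
  have hm' : (0 : ℝ) < m := by exact_mod_cast hm
  -- Telescoping with 1 / (N + 1)² ≤ 1 / N - 1 / (N + 1); the maximum covers the N for which the sum
  -- is still empty.
  have key : ∀ N : ℕ, ∑ n ∈ Finset.range N, (if n ≤ m then 0 else (((n : ℝ) + 1) ^ 2)⁻¹) ≤
      (m : ℝ)⁻¹ - ((max N m : ℕ) : ℝ)⁻¹ := by
    intro N
    induction N with
    | zero => simp
    | succ N ih =>
      rw [Finset.sum_range_succ]
      by_cases h : N ≤ m
      · rw [if_pos h, add_zero]
        refine ih.trans ?_
        have : (0 : ℝ) < ((max N m : ℕ) : ℝ) := by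
          exact_mod_cast lt_of_lt_of_le hm (le_max_right _ _)
        gcongr
        omega
      · rw [if_neg h]
        push Not at h
        rw [max_eq_left h.le] at ih
        rw [max_eq_left (by omega)]
        have hN : (0 : ℝ) < N := hm'.trans (by exact_mod_cast h)
        have h1 : (((N : ℝ) + 1) ^ 2)⁻¹ ≤ (N : ℝ)⁻¹ - ((N : ℝ) + 1)⁻¹ := by
          rw [inv_sub_inv hN.ne' (by positivity), add_sub_cancel_left, inv_eq_one_div]
          gcongr
          nlinarith
        push_cast
        linarith
  refine (key N).trans ?_
  have : (0 : ℝ) ≤ ((max N m : ℕ) : ℝ)⁻¹ := by positivity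
  linarith

theorem hasSum_intWeight_tail {m : ℕ} (hm : 1 ≤ m) :
    ∃ S ≤ 2 * (m : ℝ)⁻¹, HasSum (fun k : ℤ => if |k| ≤ m then 0 else intWeight k) S := by
  set g : ℕ → ℝ := fun n => if n ≤ m then 0 else (((n : ℝ) + 1) ^ 2)⁻¹ with hg
  have hg0 : ∀ n, 0 ≤ g n := fun n => by simp only [hg]; split_ifs <;> positivity
  have hs : Summable g := summable_of_sum_range_le hg0 (sum_range_tail_le hm)
  have hle : ∑' n, g n ≤ (m : ℝ)⁻¹ := Real.tsum_le_of_sum_range_le hg0 (sum_range_tail_le hm)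
  have hs' : Summable fun n => g (n + 1) := (summable_nat_add_iff 1).2 hs
  have hle' : ∑' n, g (n + 1) ≤ (m : ℝ)⁻¹ := by
    have := hs.tsum_eq_zero_add
    linarith [hg0 0]
  refine ⟨∑' n, g n + ∑' n, g (n + 1), by linarith, ?_⟩
  refine HasSum.of_nat_of_neg_add_one ?_ ?_
  · convert hs.hasSum using 2 with n
    simp [hg, intWeight]
  · convert hs'.hasSum using 2 with n
    have h1 : |(-((n : ℤ) + 1))| = ((n + 1 : ℕ) : ℤ) := by
      rw [abs_neg, abs_of_nonneg (by positivity)]; push_cast; rfl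
    have h2 : |((-((n : ℤ) + 1) : ℤ) : ℝ)| = ((n + 1 : ℕ) : ℝ) := by
      rw [← Int.cast_abs, h1]; simp
    simp only [hg, intWeight, h1, h2, Nat.cast_le]

theorem summable_intWeight : Summable intWeight := by
  obtain ⟨S, -, hS⟩ := hasSum_intWeight_tail (le_refl 1)
  refine (hS.summable).of_norm_bounded_eventually (g := fun k : ℤ => if |k| ≤ ((1 : ℕ) : ℤ) then 0 else intWeight k) ?_
  have : (Finset.Icc (-1 : ℤ) 1 : Set ℤ).Finite := Finset.finite_toSet _
  filter_upwards [this.compl_mem_cofinite] with k hk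
  have hk' : ¬ |k| ≤ ((1 : ℕ) : ℤ) := by
    simpa [abs_le] using hk
  rw [if_neg hk', Real.norm_of_nonneg (intWeight_nonneg k)]

/-- For k ≠ 0 one has |k - s| ≥ δ |k| and |k| + 1 ≤ 2 |k|, whence the factor 1/2. The bound is
uniform in s, as the moving σ_n require. -/
theorem mul_abs_add_one_le_abs_sub {δ s : ℝ} (hδ : 0 < δ) (h1 : δ ≤ s) (h2 : s ≤ 1 - δ) (k : ℤ) :
    δ / 2 * (|(k : ℝ)| + 1) ≤ |(k : ℝ) - s| := by
  rcases lt_trichotomy k 0 with hk | rfl | hk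
  · have hk' : (k : ℝ) ≤ -1 := by exact_mod_cast (by omega : k ≤ -1)
    rw [abs_of_nonpos (by linarith), abs_of_nonpos (by linarith)]
    nlinarith
  · simp only [Int.cast_zero, abs_zero, zero_add, mul_one, zero_sub, abs_neg]
    rw [abs_of_nonneg (by linarith)]
    linarith
  · have hk' : (1 : ℝ) ≤ k := by exact_mod_cast hk
    rw [abs_of_nonneg (by linarith), abs_of_nonneg (by linarith)]
    nlinarith

/-- The amplitude `β_q + (-1)^k ρ β_{-q}`. -/
def amplitude (β : EuclideanSpace ℂ (Fin 2)) (ρ : ℂ) (k : ℤ) : ℂ := β 0 + (-1 : ℂ) ^ k * ρ * β 1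

theorem norm_amplitude_le (β : EuclideanSpace ℂ (Fin 2)) {ρ : ℂ} (hρ : ‖ρ‖ = 1) (k : ℤ) :
    ‖amplitude β ρ k‖ ≤ 2 * ‖β‖ := by
  have h0 := PiLp.norm_apply_le β 0
  have h1 := PiLp.norm_apply_le β 1
  refine (norm_add_le _ _).trans ?_
  rw [norm_mul, norm_mul, hρ, norm_zpow, norm_neg, norm_one, one_zpow, one_mul, one_mul]
  linarith

theorem amplitude_sub (β β' : EuclideanSpace ℂ (Fin 2)) (ρ : ℂ) (k : ℤ) :
    amplitude β ρ k - amplitude β' ρ k = amplitude (β - β') ρ k := by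
  simp only [amplitude, PiLp.sub_apply]
  ring

/-- The values at k = 0 and k = 1 are β_q ± ρ β_{-q} and determine β. Nonnegative k ensures that L +
k is a degree for every L. -/
theorem exists_amplitude_ne_zero {β : EuclideanSpace ℂ (Fin 2)} (hβ : β ≠ 0) {ρ : ℂ}
    (hρ : ‖ρ‖ = 1) : ∃ k : ℤ, 0 ≤ k ∧ amplitude β ρ k ≠ 0 := by
  by_contra! h
  have h0 := h 0 le_rfl
  have h1 := h 1 zero_le_one
  simp only [amplitude, zpow_zero, zpow_one, one_mul] at h0 h1
  have hρ0 : ρ ≠ 0 := fun h => by simp [h] at hρ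
  have e0 : β 0 = 0 := by linear_combination h0 / 2 + h1 / 2
  have e1 : β 1 = 0 := by
    apply mul_left_cancel₀ hρ0
    linear_combination h0 / 2 - h1 / 2
  apply hβ
  ext i
  fin_cases i <;> simp [e0, e1]

/-! ### Coefficients of the Green combination -/

/-- The ratio between the coefficients of the Green combination at `ℓ` and its leading order
near `L`. -/
def greenRatio {d : ℕ} (q : Sph d) (L : ℕ) (s : ℝ) (ℓ : ℕ) : ℝ :=
  ‖zonalL2 ℓ q‖ / ‖zonalL2 L q‖ * ((2 * L + d - 1) / (L + ℓ + s + d - 1))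

theorem greenRatio_pos {d : ℕ} (hd : 2 ≤ d) (q : Sph d) (L : ℕ) {s : ℝ} (hs : 0 ≤ s) (ℓ : ℕ) :
    0 < greenRatio q L s ℓ := by
  have h1 := norm_zonalL2_pos (by omega : 0 < d) ℓ q
  have h2 := norm_zonalL2_pos (by omega : 0 < d) L q
  have h3 : (2 : ℝ) ≤ d := by exact_mod_cast hd
  have h4 : (0 : ℝ) ≤ L := L.cast_nonneg
  have h5 : (0 : ℝ) ≤ ℓ := ℓ.cast_nonneg
  have h6 : (0 : ℝ) < 2 * L + d - 1 := by linarith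
  have h7 : (0 : ℝ) < L + ℓ + s + d - 1 := by linarith
  unfold greenRatio
  positivity

theorem greenRatio_two_sq (q : Sph 2) (L : ℕ) {s : ℝ} (hs : 0 ≤ s) (ℓ : ℕ) :
    greenRatio q L s ℓ ^ 2 = (2 * ℓ + 1) * (2 * L + 1) / (L + ℓ + s + 1) ^ 2 := by
  have h1 := gegenNormSq_two q ℓ
  have h2 := gegenNormSq_two q L
  have h3 := gegenNormSq_pos two_pos q ℓ
  have h4 := gegenNormSq_pos two_pos q L
  rw [greenRatio, mul_pow, div_pow, norm_zonalL2_sq two_pos, norm_zonalL2_sq two_pos, div_pow]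
  have h5 : (0 : ℝ) < L + ℓ + s + 1 := by positivity
  have h6 : gegenNormSq q L = (2 * ℓ + 1) * gegenNormSq q ℓ / (2 * L + 1) := by
    field_simp; linarith
  rw [h6]
  push_cast
  have h7 : (L : ℝ) + ℓ + s + 2 - 1 = L + ℓ + s + 1 := by ring
  have h8 : 2 * (L : ℝ) + 2 - 1 = 2 * L + 1 := by ring
  rw [h7, h8]
  field_simp

theorem greenRatio_three (q : Sph 3) (L : ℕ) {s : ℝ} (hs : 0 ≤ s) (ℓ : ℕ) :
    greenRatio q L s ℓ = 2 * (ℓ + 1) / (L + ℓ + s + 2) := by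
  have h1 := gegenNormSq_three q ℓ
  have h2 := gegenNormSq_three q L
  have h3 := gegenNormSq_pos three_pos q ℓ
  have h4 := gegenNormSq_pos three_pos q L
  have h5 : (0 : ℝ) < L + ℓ + s + 2 := by positivity
  rw [← sq_eq_sq₀ (greenRatio_pos (by norm_num) q L hs ℓ).le (by positivity)]
  rw [greenRatio, mul_pow, div_pow, norm_zonalL2_sq three_pos, norm_zonalL2_sq three_pos, div_pow]
  have h6 : gegenNormSq q L = (ℓ + 1) ^ 2 * gegenNormSq q ℓ / (L + 1) ^ 2 := by
    field_simp; linarith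
  rw [h6]
  push_cast
  have h7 : (L : ℝ) + ℓ + s + 3 - 1 = L + ℓ + s + 2 := by ring
  have h8 : 2 * (L : ℝ) + 3 - 1 = 2 * (L + 1) := by ring
  rw [h7, h8]
  field_simp

/-- The dimension matters here: ‖Z_ℓ‖ grows like ℓ^{(d-1)/2} and must not outgrow the factor L + ℓ +
s + d - 1. For d = 3 the ratio tends to 2 as ℓ → ∞. -/
theorem greenRatio_le_two {d : ℕ} (hd : d = 2 ∨ d = 3) (q : Sph d) (L : ℕ) {s : ℝ} (hs : 0 ≤ s)
    (ℓ : ℕ) : greenRatio q L s ℓ ≤ 2 := by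
  have hL : (0 : ℝ) ≤ L := L.cast_nonneg
  have hl : (0 : ℝ) ≤ ℓ := ℓ.cast_nonneg
  rcases hd with rfl | rfl
  · refine le_of_sq_le_sq ?_ zero_le_two
    rw [greenRatio_two_sq q L hs, div_le_iff₀ (by positivity)]
    nlinarith [sq_nonneg ((L : ℝ) - ℓ), mul_nonneg hs hL, mul_nonneg hs hl, sq_nonneg s]
  · rw [greenRatio_three q L hs, div_le_iff₀ (by positivity)]
    nlinarith

theorem abs_greenRatio_sub_one_le {d : ℕ} (hd : d = 2 ∨ d = 3) (q : Sph d) {L m : ℕ} (hm : 1 ≤ m)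
    (hmL : m ≤ L) {s : ℝ} (hs : 0 ≤ s) (hs1 : s ≤ 1) {ℓ : ℕ} (hl : |(ℓ : ℝ) - L| ≤ m) :
    |greenRatio q L s ℓ - 1| ≤ 4 * (m / L) := by
  have hm1 : (1 : ℝ) ≤ m := by exact_mod_cast hm
  have hmL' : (m : ℝ) ≤ L := by exact_mod_cast hmL
  have hl0 : (0 : ℝ) ≤ ℓ := ℓ.cast_nonneg
  have hL : (0 : ℝ) < L := by linarith
  obtain ⟨ha, hb⟩ := abs_le.1 hl
  rcases hd with rfl | rfl
  · have hpos := greenRatio_pos le_rfl q L hs ℓ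
    have hsq := greenRatio_two_sq q L hs ℓ
    have hX : (0 : ℝ) < L + ℓ + s + 1 := by positivity
    have hle : greenRatio q L s ℓ ^ 2 ≤ 1 := by
      rw [hsq, div_le_one (by positivity)]
      nlinarith [sq_nonneg ((L : ℝ) - ℓ), mul_nonneg hs hL.le, mul_nonneg hs hl0, sq_nonneg s]
    have hle1 : greenRatio q L s ℓ ≤ 1 := by nlinarith
    rw [abs_of_nonpos (by linarith)]
    -- For d = 2 only the square is rational; as the ratio lies in [0, 1], 1 - r ≤ 1 - r².
    have h1 : 1 - greenRatio q L s ℓ ^ 2 ≤ 4 * (m / L) := by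
      have h2 : 1 - greenRatio q L s ℓ ^ 2 =
          ((ℓ - L) ^ 2 + s * (2 * (L + ℓ + 1) + s)) / (L + ℓ + s + 1) ^ 2 := by
        rw [hsq]; field_simp; ring
      rw [h2, mul_div_assoc', div_le_div_iff₀ (by positivity) hL]
      have h3 : ((ℓ : ℝ) - L) ^ 2 ≤ m * L := by nlinarith
      have h4 : s * (2 * ((L : ℝ) + ℓ + 1) + s) ≤ 2 * (L + ℓ + s + 1) := by nlinarith
      have h5 : ((ℓ : ℝ) - L) ^ 2 * L ≤ m * (L + ℓ + s + 1) ^ 2 := by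
        have : (L : ℝ) * L ≤ (L + ℓ + s + 1) ^ 2 := by nlinarith
        nlinarith [mul_le_mul_of_nonneg_right h3 hL.le]
      have h6 : s * (2 * ((L : ℝ) + ℓ + 1) + s) * L ≤ 2 * m * (L + ℓ + s + 1) ^ 2 := by
        have h7 : (L : ℝ) ≤ L + ℓ + s + 1 := by linarith
        calc s * (2 * ((L : ℝ) + ℓ + 1) + s) * L ≤ 2 * (L + ℓ + s + 1) * (L + ℓ + s + 1) := by
              gcongr
          _ ≤ m * (2 * (L + ℓ + s + 1) * (L + ℓ + s + 1)) := le_mul_of_one_le_left (by positivity) hm1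
          _ = _ := by ring
      have h8 : (0 : ℝ) ≤ m * (L + ℓ + s + 1) ^ 2 := by positivity
      nlinarith
    nlinarith
  · rw [greenRatio_three q L hs]
    have hX : (0 : ℝ) < L + ℓ + s + 2 := by positivity
    have h1 : 2 * ((ℓ : ℝ) + 1) / (L + ℓ + s + 2) - 1 = (ℓ - L - s) / (L + ℓ + s + 2) := by
      field_simp; ring
    rw [h1, abs_div, abs_of_pos hX, mul_div_assoc', div_le_div_iff₀ hX hL]
    -- The shift s is absorbed because s ≤ 1 ≤ m.
    have h2 : |(ℓ : ℝ) - L - s| ≤ 2 * m := by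
      rw [abs_le]; constructor <;> linarith
    calc |(ℓ : ℝ) - L - s| * L ≤ 2 * m * (L + ℓ + s + 2) := by
          gcongr; linarith
      _ ≤ 4 * m * (L + ℓ + s + 2) := by gcongr; norm_num

/-- The coefficients of the rescaled Green combination in the basis of zonal harmonics. -/
def greenCoeff {d : ℕ} (q : Sph d) (L : ℕ) (s : ℝ) (β : EuclideanSpace ℂ (Fin 2)) (ρ : ℂ)
    (ℓ : ℕ) : ℂ :=
  amplitude β ρ ((ℓ : ℤ) - L) / ((((ℓ : ℤ) - L : ℤ) : ℂ) - (s : ℂ)) * (greenRatio q L s ℓ : ℂ)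

theorem greenComb_eq {d : ℕ} (hd : 2 ≤ d) (q : Sph d) (L : ℕ) {s h : ℝ} (hs0 : 0 < s) (hs1 : s < 1)
    (hE : h ^ (-2 : ℤ) = ((L : ℝ) + s) * ((L : ℝ) + s + ((d : ℝ) - 1)))
    (β : EuclideanSpace ℂ (Fin 2)) :
    greenComb h (antipodalPair q) β = ((‖zonalL2 L q‖ / (2 * L + d - 1) : ℝ) : ℂ) •
      ∑' ℓ, greenCoeff q L s β ((-1) ^ L) ℓ • normZonal ℓ q := by
  have hd0 : 0 < d := by omega
  have hd2 : (2 : ℝ) ≤ d := by exact_mod_cast hd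
  rw [greenComb, ← tsum_const_smul'']
  refine tsum_congr fun ℓ => ?_
  have hL : (0 : ℝ) ≤ L := L.cast_nonneg
  have hl : (0 : ℝ) ≤ ℓ := ℓ.cast_nonneg
  have hk : (((ℓ : ℤ) - L : ℤ) : ℝ) - s ≠ 0 := by
    intro h0
    have h1 : ((((ℓ : ℤ) - L : ℤ)) : ℝ) = s := by linarith
    have h2 : (0 : ℝ) < (((ℓ : ℤ) - L : ℤ) : ℝ) := h1 ▸ hs0
    have h3 : ((((ℓ : ℤ) - L : ℤ)) : ℝ) < 1 := h1 ▸ hs1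
    have h4 : (0 : ℤ) < (ℓ : ℤ) - L := by exact_mod_cast h2
    have h5 : (ℓ : ℤ) - L < 1 := by exact_mod_cast h3
    omega
  have hX : (L : ℝ) + ℓ + s + d - 1 ≠ 0 := by
    have : (0 : ℝ) < L + ℓ + s + d - 1 := by linarith
    exact this.ne'
  have hY : 2 * (L : ℝ) + d - 1 ≠ 0 := by
    have : (0 : ℝ) < 2 * (L : ℝ) + d - 1 := by linarith
    exact this.ne'
  -- Both energies are values of t(t + d - 1), at ℓ and at L + s, so the difference has the factor ℓ
  -- - L - s.
  have hdiff : lamSq d ℓ - h ^ (-2 : ℤ) =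
      ((((ℓ : ℤ) - L : ℤ) : ℝ) - s) * (L + ℓ + s + d - 1) := by
    rw [hE, lamSq]; push_cast; ring
  have ha := norm_zonalL2_pos hd0 L q
  have hamp : amplitude β ((-1) ^ L) ((ℓ : ℤ) - L) = β 0 + (-1) ^ ℓ * β 1 := by
    rw [amplitude, ← zpow_natCast (-1 : ℂ) L, ← zpow_add₀ (by norm_num), sub_add_cancel,
      zpow_natCast]
  have hsum : ∑ i, β i • zonalL2 ℓ (antipodalPair q i) =
      ((β 0 + (-1) ^ ℓ * β 1) * (‖zonalL2 ℓ q‖ : ℂ)) • normZonal ℓ q := by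
    rw [Fin.sum_univ_two, mul_smul, ← zonalL2_eq_norm_smul_normZonal hd0]
    simp only [antipodalPair, Matrix.cons_val_zero, Matrix.cons_val_one, zonalL2_neg hd0]
    rw [add_smul, smul_smul, mul_comm]
  rw [hsum, hdiff, smul_smul, smul_smul, greenCoeff, hamp, greenRatio]
  congr 1
  have hk' : ((((ℓ : ℤ) - L : ℤ) : ℂ) - (s : ℂ)) ≠ 0 := by exact_mod_cast hk
  have hX' : (L : ℂ) + ℓ + s + d - 1 ≠ 0 := by exact_mod_cast hX
  have hY' : 2 * (L : ℂ) + d - 1 ≠ 0 := by exact_mod_cast hY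
  have ha' : (‖zonalL2 L q‖ : ℂ) ≠ 0 := by exact_mod_cast ha.ne'
  push_cast at hk' ⊢
  field_simp
  rw [eq_div_iff (by rwa [mul_comm (L : ℂ)])]

/-- The coefficients of the limit quasimode, truncated at distance `m` from `L`. -/
def limitCoeff (L m : ℕ) (σ : ℝ) (β : EuclideanSpace ℂ (Fin 2)) (ρ : ℂ) (ℓ : ℕ) : ℂ :=
  if |(ℓ : ℤ) - L| ≤ m then
    amplitude β ρ ((ℓ : ℤ) - L) / ((((ℓ : ℤ) - L : ℤ) : ℂ) - (σ : ℂ)) else 0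

/-- As m ≤ L, every L + k in the window is nonnegative and `toNat` truncates nothing. -/
theorem sum_Icc_int_eq_sum_Icc_nat {E : Type*} [AddCommMonoid E] (f : ℤ → ℕ → E) {L m : ℕ}
    (hmL : m ≤ L) : ∑ k ∈ Finset.Icc (-(m : ℤ)) (m : ℤ), f k ((L : ℤ) + k).toNat =
      ∑ ℓ ∈ Finset.Icc (L - m) (L + m), f ((ℓ : ℤ) - L) ℓ := by
  refine Finset.sum_nbij' (fun k => ((L : ℤ) + k).toNat) (fun ℓ => (ℓ : ℤ) - L) ?_ ?_ ?_ ?_ ?_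
  · intro k hk
    simp only [Finset.mem_Icc] at hk ⊢
    omega
  · intro k hk
    simp only [Finset.mem_Icc] at hk ⊢
    omega
  · intro k hk
    simp only [Finset.mem_Icc] at hk
    omega
  · intro k hk
    simp only [Finset.mem_Icc] at hk
    omega
  · intro k hk
    simp only [Finset.mem_Icc] at hk
    have h1 : ((((L : ℤ) + k).toNat : ℕ) : ℤ) - L = k := by omega
    rw [h1]

theorem abs_sub_le_iff_mem_Icc {L m ℓ : ℕ} (hmL : m ≤ L) :
    |(ℓ : ℤ) - L| ≤ m ↔ ℓ ∈ Finset.Icc (L - m) (L + m) := by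
  rw [abs_le, Finset.mem_Icc]
  omega

theorem sum_Icc_eq_tsum_limitCoeff {E : Type*} [NormedAddCommGroup E] [NormedSpace ℂ E] (z : ℕ → E)
    {L m : ℕ} (hmL : m ≤ L) (σ : ℝ) (β : EuclideanSpace ℂ (Fin 2)) (ρ : ℂ) :
    ∑ k ∈ Finset.Icc (-(m : ℤ)) (m : ℤ),
      (amplitude β ρ k / ((k : ℂ) - (σ : ℂ))) • z ((L : ℤ) + k).toNat =
      ∑' ℓ, limitCoeff L m σ β ρ ℓ • z ℓ := by
  rw [tsum_eq_sum (s := Finset.Icc (L - m) (L + m)),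
    sum_Icc_int_eq_sum_Icc_nat (fun k ℓ => (amplitude β ρ k / ((k : ℂ) - (σ : ℂ))) • z ℓ) hmL]
  · refine Finset.sum_congr rfl fun ℓ hℓ => ?_
    rw [limitCoeff, if_pos ((abs_sub_le_iff_mem_Icc hmL).2 hℓ)]
  · intro ℓ hℓ
    rw [limitCoeff, if_neg (fun h => hℓ ((abs_sub_le_iff_mem_Icc hmL).1 h)), zero_smul]

theorem norm_sum_Icc_sq {E : Type*} [NormedAddCommGroup E] [InnerProductSpace ℂ E] {z : ℕ → E}
    (hz : Orthonormal ℂ z) {L m : ℕ} (hmL : m ≤ L) (a : ℤ → ℂ) :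
    ‖∑ k ∈ Finset.Icc (-(m : ℤ)) (m : ℤ), a k • z ((L : ℤ) + k).toNat‖ ^ 2 =
      ∑ k ∈ Finset.Icc (-(m : ℤ)) (m : ℤ), ‖a k‖ ^ 2 := by
  rw [sum_Icc_int_eq_sum_Icc_nat (fun k ℓ => a k • z ℓ) hmL, hz.norm_sum_smul_sq,
    sum_Icc_int_eq_sum_Icc_nat (fun k _ => ‖a k‖ ^ 2) hmL]

/-! ### The constant C_{σ,β,ρ} and its truncations -/

theorem norm_intCast_sub_ofReal (k : ℤ) (s : ℝ) : ‖(k : ℂ) - (s : ℂ)‖ = |(k : ℝ) - s| := by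
  rw [← Complex.ofReal_intCast, ← Complex.ofReal_sub, Complex.norm_real, Real.norm_eq_abs]

theorem norm_div_sub_le {δ s : ℝ} (hδ : 0 < δ) (h1 : δ ≤ s) (h2 : s ≤ 1 - δ) (a : ℂ) (k : ℤ) :
    ‖a / ((k : ℂ) - (s : ℂ))‖ ≤ ‖a‖ * (2 / δ) / (|(k : ℝ)| + 1) := by
  have h := mul_abs_add_one_le_abs_sub hδ h1 h2 k
  have h3 : 0 < |(k : ℝ)| + 1 := by positivity
  rw [norm_div, norm_intCast_sub_ofReal, mul_div_assoc]
  have h4 : 0 < δ / 2 * (|(k : ℝ)| + 1) := by positivity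
  rw [div_eq_mul_inv]
  gcongr
  calc |(k : ℝ) - s|⁻¹ ≤ (δ / 2 * (|(k : ℝ)| + 1))⁻¹ := by gcongr
    _ = _ := by field_simp

/-- Comparison with `intWeight` makes the series converge, so the `tsum` in `quasimodeConst` is a
genuine sum and not the default 0. -/
theorem hasSum_quasimodeConst_terms {δ σ : ℝ} (hδ : 0 < δ) (h1 : δ ≤ σ) (h2 : σ ≤ 1 - δ)
    (β : EuclideanSpace ℂ (Fin 2)) {ρ : ℂ} (hρ : ‖ρ‖ = 1) :
    (∀ k : ℤ, ‖amplitude β ρ k / ((k : ℂ) - (σ : ℂ))‖ ^ 2 ≤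
      (2 * ‖β‖ * (2 / δ)) ^ 2 * intWeight k) ∧
    HasSum (fun k : ℤ => ‖amplitude β ρ k / ((k : ℂ) - (σ : ℂ))‖ ^ 2)
      (quasimodeConst σ β ρ ^ 2) := by
  have hle : ∀ k : ℤ, ‖amplitude β ρ k / ((k : ℂ) - (σ : ℂ))‖ ^ 2 ≤
      (2 * ‖β‖ * (2 / δ)) ^ 2 * intWeight k := by
    intro k
    have h3 : 0 < |(k : ℝ)| + 1 := by positivity
    have h := (norm_div_sub_le hδ h1 h2 (amplitude β ρ k) k).trans
      (div_le_div_of_nonneg_right (mul_le_mul_of_nonneg_right (norm_amplitude_le β hρ k)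
        (by positivity : 0 ≤ 2 / δ)) h3.le)
    calc _ ≤ (2 * ‖β‖ * (2 / δ) / (|(k : ℝ)| + 1)) ^ 2 := by gcongr
      _ = _ := by rw [intWeight, div_pow, div_eq_mul_inv]
  refine ⟨hle, ?_⟩
  have hs : Summable (fun k : ℤ => ‖amplitude β ρ k / ((k : ℂ) - (σ : ℂ))‖ ^ 2) :=
    Summable.of_nonneg_of_le (fun k => by positivity) hle (summable_intWeight.mul_left _)
  have heq : ∀ k : ℤ, ‖amplitude β ρ k / ((k : ℂ) - (σ : ℂ))‖ ^ 2 =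
      ‖β 0 + (-1 : ℂ) ^ k * ρ * β 1‖ ^ 2 / ((k : ℝ) - σ) ^ 2 := by
    intro k
    rw [norm_div, norm_intCast_sub_ofReal, div_pow, sq_abs, amplitude]
  rw [quasimodeConst, Real.sq_sqrt (tsum_nonneg fun k => by positivity)]
  convert hs.hasSum using 1
  exact tsum_congr fun k => (heq k).symm

theorem quasimodeConst_pos {δ σ : ℝ} (hδ : 0 < δ) (h1 : δ ≤ σ) (h2 : σ ≤ 1 - δ)
    {β : EuclideanSpace ℂ (Fin 2)} (hβ : β ≠ 0) {ρ : ℂ} (hρ : ‖ρ‖ = 1) :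
    0 < quasimodeConst σ β ρ := by
  obtain ⟨k, -, hk⟩ := exists_amplitude_ne_zero hβ hρ
  have h := (hasSum_quasimodeConst_terms hδ h1 h2 β hρ).2
  have hks : (k : ℂ) - (σ : ℂ) ≠ 0 := by
    rw [← norm_pos_iff, norm_intCast_sub_ofReal]
    exact lt_of_lt_of_le (by positivity) (mul_abs_add_one_le_abs_sub hδ h1 h2 k)
  have h3 : 0 < quasimodeConst σ β ρ ^ 2 := by
    rw [← h.tsum_eq]
    exact h.summable.tsum_pos (fun k => by positivity) k
      (by have := div_ne_zero hk hks; positivity)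
  exact lt_of_le_of_ne (Real.sqrt_nonneg _) fun h0 => by simp [← h0] at h3

/-- With T the truncated sum, C² - ‖T‖² is the tail of the series, hence O(1 / m); and (C - ‖T‖)² ≤
C² - ‖T‖² because 0 ≤ ‖T‖ ≤ C. -/
theorem abs_quasimodeConst_sub_norm_le {E : Type*} [NormedAddCommGroup E] [InnerProductSpace ℂ E]
    {z : ℕ → E} (hz : Orthonormal ℂ z) {L m : ℕ} (hm : 1 ≤ m) (hmL : m ≤ L) {δ σ : ℝ} (hδ : 0 < δ)
    (h1 : δ ≤ σ) (h2 : σ ≤ 1 - δ) (β : EuclideanSpace ℂ (Fin 2)) {ρ : ℂ} (hρ : ‖ρ‖ = 1) :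
    |quasimodeConst σ β ρ - ‖∑ k ∈ Finset.Icc (-(m : ℤ)) (m : ℤ),
      (amplitude β ρ k / ((k : ℂ) - (σ : ℂ))) • z ((L : ℤ) + k).toNat‖| ≤
      2 * ‖β‖ * (2 / δ) * (2 * (m : ℝ) ^ (-(1 / 2) : ℝ)) := by
  obtain ⟨hle, hsum⟩ := hasSum_quasimodeConst_terms hδ h1 h2 β hρ
  obtain ⟨S, hS, htail⟩ := hasSum_intWeight_tail hm
  set T := ∑ k ∈ Finset.Icc (-(m : ℤ)) (m : ℤ),
      (amplitude β ρ k / ((k : ℂ) - (σ : ℂ))) • z ((L : ℤ) + k).toNat with hT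
  have hm0 : (0 : ℝ) < m := by exact_mod_cast hm
  have hr : ((m : ℝ) ^ (-(1 / 2) : ℝ)) ^ 2 = (m : ℝ)⁻¹ := by
    rw [← Real.rpow_natCast, ← Real.rpow_mul hm0.le]
    norm_num [Real.rpow_neg_one]
  have hr0 : 0 ≤ (m : ℝ) ^ (-(1 / 2) : ℝ) := by positivity
  have hTn : ‖T‖ ^ 2 = ∑ k ∈ Finset.Icc (-(m : ℤ)) (m : ℤ),
      ‖amplitude β ρ k / ((k : ℂ) - (σ : ℂ))‖ ^ 2 := norm_sum_Icc_sq hz hmL _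
  have hfin : HasSum (fun k : ℤ => if |k| ≤ m then
      ‖amplitude β ρ k / ((k : ℂ) - (σ : ℂ))‖ ^ 2 else 0) (‖T‖ ^ 2) := by
    rw [hTn, Finset.sum_congr rfl fun k hk => (if_pos (abs_le.2 (Finset.mem_Icc.1 hk))).symm]
    refine hasSum_sum_of_ne_finset_zero fun k hk => if_neg fun h => hk ?_
    exact Finset.mem_Icc.2 (abs_le.1 h)
  have hdiff := hsum.sub hfin
  have h3 : quasimodeConst σ β ρ ^ 2 - ‖T‖ ^ 2 ≤ (2 * ‖β‖ * (2 / δ)) ^ 2 * S := by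
    refine hasSum_le (fun k => ?_) hdiff (htail.mul_left _)
    by_cases h : |k| ≤ m
    · simp [h]
    · simpa [h] using hle k
  have h4 : 0 ≤ quasimodeConst σ β ρ ^ 2 - ‖T‖ ^ 2 := by
    refine hasSum_le (fun k => ?_) hasSum_zero hdiff
    by_cases h : |k| ≤ m
    · simp [h]
    · simp only [h, if_false, sub_zero]; positivity
  have hC0 : 0 ≤ quasimodeConst σ β ρ := Real.sqrt_nonneg _
  have h5 : ‖T‖ ≤ quasimodeConst σ β ρ := by
    refine le_of_sq_le_sq (by linarith) hC0
  have h6 : (quasimodeConst σ β ρ - ‖T‖) ^ 2 ≤ quasimodeConst σ β ρ ^ 2 - ‖T‖ ^ 2 := by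
    nlinarith [norm_nonneg T]
  refine abs_le_of_sq_le_sq ?_ (by positivity)
  refine h6.trans (h3.trans ?_)
  rw [mul_pow (2 * ‖β‖ * (2 / δ)) (2 * _), mul_pow 2 (_ ^ _), hr]
  gcongr
  have : (0 : ℝ) ≤ (m : ℝ)⁻¹ := by positivity
  linarith

/-! ### Distance of the Green combination to the truncated limit -/

theorem norm_greenCoeff_sub_limitCoeff_sq_le {d : ℕ} (hd : d = 2 ∨ d = 3) (q : Sph d) {L m : ℕ}
    (hm : 1 ≤ m) (hmL : m ≤ L) {δ s σ B : ℝ} (hδ : 0 < δ) (hs1 : δ ≤ s)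
    (hs2 : s ≤ 1 - δ) (hσ1 : δ ≤ σ) (hσ2 : σ ≤ 1 - δ) {β β' : EuclideanSpace ℂ (Fin 2)} {ρ : ℂ}
    (hρ : ‖ρ‖ = 1) (hB : 1 ≤ B) (hβ : 2 * ‖β‖ ≤ B) (hβ' : 2 * ‖β'‖ ≤ B) (ℓ : ℕ) :
    ‖greenCoeff q L s β' ρ ℓ - limitCoeff L m σ β ρ ℓ‖ ^ 2 ≤
      (4 * B * (2 / δ) ^ 2) ^ 2 *
        ((m / L + |s - σ| + ‖β' - β‖) ^ 2 * intWeight ((ℓ : ℤ) - L) +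
          if |(ℓ : ℤ) - L| ≤ m then 0 else intWeight ((ℓ : ℤ) - L)) := by
  set k : ℤ := (ℓ : ℤ) - L with hk
  set K : ℝ := 2 / δ with hK
  set η : ℝ := m / L + |s - σ| + ‖β' - β‖ with hη
  have hη0 : 0 ≤ η := by positivity
  have hK1 : 1 ≤ K := by rw [hK, le_div_iff₀ hδ]; linarith
  have hD : 0 < |(k : ℝ)| + 1 := by positivity
  have hD1 : 1 ≤ |(k : ℝ)| + 1 := by linarith [abs_nonneg (k : ℝ)]
  have hP : intWeight k = (1 / (|(k : ℝ)| + 1)) ^ 2 := by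
    rw [intWeight, one_div, inv_pow]
  have hKK : K ≤ K ^ 2 := by nlinarith
  have hd2 : 2 ≤ d := by omega
  have ha' : ‖amplitude β' ρ k / ((k : ℂ) - (s : ℂ))‖ ≤ B * K * (1 / (|(k : ℝ)| + 1)) := by
    refine (norm_div_sub_le hδ hs1 hs2 _ k).trans ?_
    rw [div_eq_mul_one_div]
    have := (norm_amplitude_le β' hρ k).trans hβ'
    gcongr
  have hw0 := greenRatio_pos hd2 q L (hδ.le.trans hs1) ℓ
  have hw2 := greenRatio_le_two hd q L (hδ.le.trans hs1) ℓ
  by_cases h : |k| ≤ m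
  · have h1 : greenCoeff q L s β' ρ ℓ - limitCoeff L m σ β ρ ℓ =
        amplitude β' ρ k / ((k : ℂ) - (s : ℂ)) * ((greenRatio q L s ℓ - 1 : ℝ) : ℂ)
        + amplitude (β' - β) ρ k / ((k : ℂ) - (s : ℂ))
        + (amplitude β ρ k * ((s - σ : ℝ) : ℂ) / ((k : ℂ) - (s : ℂ))) / ((k : ℂ) - (σ : ℂ)) := by
      have hne : ∀ t : ℝ, δ ≤ t → t ≤ 1 - δ → (k : ℂ) - (t : ℂ) ≠ 0 := fun t ht1 ht2 => by
        rw [← norm_pos_iff, norm_intCast_sub_ofReal]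
        exact lt_of_lt_of_le (by positivity) (mul_abs_add_one_le_abs_sub hδ ht1 ht2 k)
      have hs' := hne s hs1 hs2
      have hσ' := hne σ hσ1 hσ2
      rw [greenCoeff, limitCoeff, ← hk, if_pos h, ← amplitude_sub]
      push_cast
      field_simp
      ring
    have hw1 : |greenRatio q L s ℓ - 1| ≤ 4 * (m / L) := by
      refine abs_greenRatio_sub_one_le hd q hm hmL (hδ.le.trans hs1) (by linarith) ?_
      have : |(k : ℝ)| ≤ m := by exact_mod_cast h
      rw [hk] at this
      exact_mod_cast this
    have e1 : ‖amplitude β' ρ k / ((k : ℂ) - (s : ℂ)) * ((greenRatio q L s ℓ - 1 : ℝ) : ℂ)‖ ≤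
        4 * B * K ^ 2 * (m / L) * (1 / (|(k : ℝ)| + 1)) := by
      rw [norm_mul, Complex.norm_real, Real.norm_eq_abs]
      calc _ ≤ B * K * (1 / (|(k : ℝ)| + 1)) * (4 * (m / L)) := by gcongr
        _ ≤ B * K ^ 2 * (1 / (|(k : ℝ)| + 1)) * (4 * (m / L)) := by gcongr
        _ = _ := by ring
    have e2 : ‖amplitude (β' - β) ρ k / ((k : ℂ) - (s : ℂ))‖ ≤
        4 * B * K ^ 2 * ‖β' - β‖ * (1 / (|(k : ℝ)| + 1)) := by
      refine (norm_div_sub_le hδ hs1 hs2 _ k).trans ?_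
      rw [div_eq_mul_one_div]
      have := norm_amplitude_le (β' - β) hρ k
      calc _ ≤ 2 * ‖β' - β‖ * K * (1 / (|(k : ℝ)| + 1)) := by gcongr
        _ = 2 * K * ‖β' - β‖ * (1 / (|(k : ℝ)| + 1)) := by ring
        _ ≤ _ := by gcongr; nlinarith
    have e3 : ‖(amplitude β ρ k * ((s - σ : ℝ) : ℂ) / ((k : ℂ) - (s : ℂ))) / ((k : ℂ) - (σ : ℂ))‖ ≤
        4 * B * K ^ 2 * |s - σ| * (1 / (|(k : ℝ)| + 1)) := by
      refine (norm_div_sub_le hδ hσ1 hσ2 _ k).trans ?_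
      rw [div_eq_mul_one_div]
      have h3 : ‖amplitude β ρ k * ((s - σ : ℝ) : ℂ) / ((k : ℂ) - (s : ℂ))‖ ≤ B * |s - σ| * K := by
        refine (norm_div_sub_le hδ hs1 hs2 _ k).trans ?_
        rw [norm_mul, Complex.norm_real, Real.norm_eq_abs]
        have := (norm_amplitude_le β hρ k).trans hβ
        -- One of the two factors 1 / (|k| + 1) is discarded; a single one suffices for square
        -- summability.
        refine (div_le_self (by positivity) hD1).trans ?_
        gcongr
      calc _ ≤ B * |s - σ| * K * K * (1 / (|(k : ℝ)| + 1)) := by gcongr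
        _ = 1 * B * K ^ 2 * |s - σ| * (1 / (|(k : ℝ)| + 1)) := by ring
        _ ≤ _ := by gcongr; norm_num
    have e4 : ‖greenCoeff q L s β' ρ ℓ - limitCoeff L m σ β ρ ℓ‖ ≤
        4 * B * K ^ 2 * (η * (1 / (|(k : ℝ)| + 1))) := by
      rw [h1]
      refine (norm_add₃_le).trans ((add_le_add_three e1 e2 e3).trans (le_of_eq ?_))
      rw [hη]; ring
    rw [if_pos h, add_zero, hP, ← mul_pow, ← mul_pow]
    gcongr
  · rw [limitCoeff, ← hk, if_neg h, if_neg h, sub_zero, greenCoeff, ← hk]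
    have e : ‖amplitude β' ρ k / ((k : ℂ) - (s : ℂ)) * (greenRatio q L s ℓ : ℂ)‖ ≤
        4 * B * K ^ 2 * (1 / (|(k : ℝ)| + 1)) := by
      rw [norm_mul, Complex.norm_real, Real.norm_eq_abs, abs_of_pos hw0]
      calc _ ≤ B * K * (1 / (|(k : ℝ)| + 1)) * 2 := by gcongr
        _ = 2 * B * K * (1 / (|(k : ℝ)| + 1)) := by ring
        _ ≤ _ := by gcongr; norm_num
    calc _ ≤ (4 * B * K ^ 2 * (1 / (|(k : ℝ)| + 1))) ^ 2 := by gcongr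
      _ = (4 * B * K ^ 2) ^ 2 * (0 + intWeight k) := by rw [mul_pow, hP, zero_add]
      _ ≤ _ := by
        gcongr
        exact mul_nonneg (sq_nonneg _) (intWeight_nonneg k)

/-- The injection ℓ ↦ ℓ - L bounds the sum over degrees by one over all integers, so the weights
contribute a constant free of L. -/
theorem sum_norm_greenCoeff_sub_limitCoeff_sq_le {d : ℕ} (hd : d = 2 ∨ d = 3) (q : Sph d) {L m : ℕ}
    (hm : 1 ≤ m) (hmL : m ≤ L) {δ s σ B : ℝ} (hδ : 0 < δ) (hs1 : δ ≤ s)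
    (hs2 : s ≤ 1 - δ) (hσ1 : δ ≤ σ) (hσ2 : σ ≤ 1 - δ) {β β' : EuclideanSpace ℂ (Fin 2)} {ρ : ℂ}
    (hρ : ‖ρ‖ = 1) (hB : 1 ≤ B) (hβ : 2 * ‖β‖ ≤ B) (hβ' : 2 * ‖β'‖ ≤ B) :
    (Summable fun ℓ => ‖greenCoeff q L s β' ρ ℓ - limitCoeff L m σ β ρ ℓ‖ ^ 2) ∧
    ∑' ℓ, ‖greenCoeff q L s β' ρ ℓ - limitCoeff L m σ β ρ ℓ‖ ^ 2 ≤
      (4 * B * (2 / δ) ^ 2) ^ 2 *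
        ((m / L + |s - σ| + ‖β' - β‖) ^ 2 * (∑' k, intWeight k) + 2 * (m : ℝ)⁻¹) := by
  have hle := norm_greenCoeff_sub_limitCoeff_sq_le hd q hm hmL hδ hs1 hs2 hσ1 hσ2 hρ hB hβ hβ'
  obtain ⟨S, hS, htail⟩ := hasSum_intWeight_tail hm
  set A : ℝ := (4 * B * (2 / δ) ^ 2) ^ 2
  set η : ℝ := (m / L + |s - σ| + ‖β' - β‖) ^ 2
  let g : ℤ → ℝ := fun k => A * (η * intWeight k + if |k| ≤ m then 0 else intWeight k)
  have hg : HasSum g (A * (η * (∑' k, intWeight k) + S)) :=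
    ((summable_intWeight.hasSum.mul_left η).add htail).mul_left A
  have hg0 : ∀ k, 0 ≤ g k := fun k => by
    have := intWeight_nonneg k
    have : 0 ≤ (if |k| ≤ (m : ℤ) then 0 else intWeight k) := by split_ifs <;> simp [this]
    simp only [g]
    positivity
  have hinj : Function.Injective (fun ℓ : ℕ => (ℓ : ℤ) - L) := fun a b hab => by
    simp only at hab; omega
  have hgs : Summable fun ℓ : ℕ => g ((ℓ : ℤ) - L) := hg.summable.comp_injective hinj
  have hs := Summable.of_nonneg_of_le (fun ℓ => sq_nonneg _) hle hgs
  refine ⟨hs, (hs.tsum_le_tsum hle hgs).trans ?_⟩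
  refine (tsum_comp_le_tsum_of_inj hg.summable hg0 hinj).trans ?_
  rw [hg.tsum_eq]
  gcongr

/-- The distance of the rescaled Green combination to the truncated limit quasimode. -/
theorem norm_tsum_greenCoeff_sub_le {d : ℕ} (hd : d = 2 ∨ d = 3) (q : Sph d) {L m : ℕ}
    (hm : 1 ≤ m) (hmL : m ≤ L) {δ s σ B : ℝ} (hδ : 0 < δ) (hs1 : δ ≤ s)
    (hs2 : s ≤ 1 - δ) (hσ1 : δ ≤ σ) (hσ2 : σ ≤ 1 - δ) {β β' : EuclideanSpace ℂ (Fin 2)} {ρ : ℂ}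
    (hρ : ‖ρ‖ = 1) (hB : 1 ≤ B) (hβ : 2 * ‖β‖ ≤ B) (hβ' : 2 * ‖β'‖ ≤ B) :
    (Summable fun ℓ => ‖greenCoeff q L s β' ρ ℓ‖ ^ 2) ∧
    ‖∑' ℓ, greenCoeff q L s β' ρ ℓ • normZonal ℓ q - ∑ k ∈ Finset.Icc (-(m : ℤ)) (m : ℤ),
      (amplitude β ρ k / ((k : ℂ) - (σ : ℂ))) • normZonal ((L : ℤ) + k).toNat q‖ ≤
      4 * B * (2 / δ) ^ 2 * (√(∑' k, intWeight k) * (m / L + |s - σ| + ‖β' - β‖) +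
        2 * (m : ℝ) ^ (-(1 / 2) : ℝ)) := by
  have hz : Orthonormal ℂ (fun ℓ => normZonal ℓ q) := orthonormal_normZonal (by omega) q
  obtain ⟨hsum, hle⟩ := sum_norm_greenCoeff_sub_limitCoeff_sq_le hd q hm hmL hδ hs1 hs2 hσ1 hσ2 hρ
    hB hβ hβ'
  have hst : Summable fun ℓ => limitCoeff L m σ β ρ ℓ • normZonal ℓ q := by
    refine summable_of_ne_finset_zero (s := Finset.Icc (L - m) (L + m)) fun ℓ hℓ => ?_
    rw [limitCoeff, if_neg (fun h => hℓ ((abs_sub_le_iff_mem_Icc hmL).1 h)), zero_smul]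
  have hsd := hz.summable_smul_iff.2 hsum
  have hadd : (fun ℓ => greenCoeff q L s β' ρ ℓ • normZonal ℓ q) = fun ℓ =>
      (greenCoeff q L s β' ρ ℓ - limitCoeff L m σ β ρ ℓ) • normZonal ℓ q +
        limitCoeff L m σ β ρ ℓ • normZonal ℓ q := by
    ext1 ℓ
    rw [← add_smul, sub_add_cancel]
  refine ⟨hz.summable_smul_iff.1 (hadd ▸ hsd.add hst), ?_⟩
  rw [sum_Icc_eq_tsum_limitCoeff (fun ℓ => normZonal ℓ q) hmL, hadd, hsd.tsum_add hst,
    add_sub_cancel_right]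
  have hm0 : (0 : ℝ) < m := by exact_mod_cast hm
  have hr : ((m : ℝ) ^ (-(1 / 2) : ℝ)) ^ 2 = (m : ℝ)⁻¹ := by
    rw [← Real.rpow_natCast, ← Real.rpow_mul hm0.le]
    norm_num [Real.rpow_neg_one]
  have hr0 : 0 ≤ (m : ℝ) ^ (-(1 / 2) : ℝ) := by positivity
  have hS : 0 ≤ ∑' k, intWeight k := tsum_nonneg intWeight_nonneg
  refine le_of_sq_le_sq ?_ (by positivity)
  rw [← (hz.hasSum_norm_sq hsum).tsum_eq, mul_pow _ (_ + _)]
  refine hle.trans ?_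
  gcongr
  rw [← hr]
  have h1 := Real.sq_sqrt hS
  have h2 : 0 ≤ √(∑' k, intWeight k) * (m / L + |s - σ| + ‖β' - β‖) := by positivity
  have h3 := mul_nonneg h2 hr0
  have h4 : (√(∑' k, intWeight k) * (m / L + |s - σ| + ‖β' - β‖)) ^ 2 =
      (m / L + |s - σ| + ‖β' - β‖) ^ 2 * ∑' k, intWeight k := by rw [mul_pow, h1, mul_comm]
  nlinarith [sq_nonneg ((m : ℝ) ^ (-(1 / 2) : ℝ))]

/-- By Parseval a zero sum has only zero coefficients, while the one at some degree L + k with k ≥ 0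
has nonzero amplitude. -/
theorem tsum_greenCoeff_ne_zero {d : ℕ} (hd : 2 ≤ d) (q : Sph d) (L : ℕ) {s : ℝ} (hs0 : 0 < s)
    (hs1 : s < 1) {β : EuclideanSpace ℂ (Fin 2)} (hβ : β ≠ 0) {ρ : ℂ} (hρ : ‖ρ‖ = 1)
    (hsum : Summable fun ℓ => ‖greenCoeff q L s β ρ ℓ‖ ^ 2) :
    ∑' ℓ, greenCoeff q L s β ρ ℓ • normZonal ℓ q ≠ 0 := by
  intro h0
  have h := (orthonormal_normZonal (by omega : 0 < d) q).hasSum_norm_sq hsum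
  rw [h0, norm_zero, zero_pow two_ne_zero,
    hasSum_zero_iff_of_nonneg (fun ℓ => by positivity)] at h
  obtain ⟨k, hk0, hk⟩ := exists_amplitude_ne_zero hβ hρ
  have h1 : ‖greenCoeff q L s β ρ (L + k.toNat)‖ ^ 2 = 0 := congrFun h _
  have h2 : ((L + k.toNat : ℕ) : ℤ) - L = k := by omega
  have h3 := greenRatio_pos hd q L hs0.le (L + k.toNat)
  rw [sq_eq_zero_iff, norm_eq_zero, greenCoeff, h2, mul_eq_zero, div_eq_zero_iff] at h1
  rcases h1 with (h1 | h1) | h1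
  · exact hk h1
  · have hδ : 0 < min s (1 - s) := lt_min hs0 (by linarith)
    have h4 := mul_abs_add_one_le_abs_sub hδ (min_le_left _ _)
      (by linarith [min_le_right s (1 - s)]) k
    rw [← norm_intCast_sub_ofReal, h1, norm_zero] at h4
    have : 0 < min s (1 - s) / 2 * (|(k : ℝ)| + 1) := by positivity
    linarith
  · exact h3.ne' (by exact_mod_cast h1)

/-- Small h forces L to be large, and 1 / L is controlled by h; both are needed to pass from L to h.
-/
theorem inv_le_of_zpow_eq {d L : ℕ} {h s : ℝ} (hd : 1 ≤ d) (hs0 : 0 ≤ s) (hs1 : s ≤ 1)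
    (hE : h ^ (-2 : ℤ) = ((L : ℝ) + s) * ((L : ℝ) + s + ((d : ℝ) - 1))) : h⁻¹ ≤ L + d := by
  have hL : (0 : ℝ) ≤ L := L.cast_nonneg
  have hd' : (1 : ℝ) ≤ d := by exact_mod_cast hd
  refine le_of_sq_le_sq ?_ (by positivity)
  rw [inv_pow, ← zpow_natCast, ← zpow_neg]
  have : (-((2 : ℕ) : ℤ)) = -2 := by norm_num
  rw [this, hE, sq]
  exact mul_le_mul (by linarith) (by linarith) (by linarith) (by linarith)

theorem normalize_smul_of_pos {E : Type*} [NormedAddCommGroup E] [NormedSpace ℂ E] {τ : ℝ}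
    (hτ : 0 < τ) (x : E) :
    ((‖(τ : ℂ) • x‖⁻¹ : ℝ) : ℂ) • (τ : ℂ) • x = ((‖x‖⁻¹ : ℝ) : ℂ) • x := by
  rw [norm_smul, Complex.norm_real, Real.norm_eq_abs, abs_of_pos hτ, smul_smul, mul_inv,
    ← Complex.ofReal_mul]
  congr 2
  field_simp

end

/-! ### The main theorem -/

theorem theorem4p4 (d : ℕ) (hd : d = 2 ∨ d = 3) (q : Sph d)
    (h : ℕ → ℝ) (βs : ℕ → EuclideanSpace ℂ (Fin 2)) (ℓ : ℕ → ℕ) (σs : ℕ → ℝ)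
    (hh : ∀ n, h n ∈ Set.Ioo (0 : ℝ) 1)
    (hσs : ∀ n, σs n ∈ Set.Ico (0 : ℝ) 1)
    (hdef : ∀ n, (h n) ^ (-2 : ℤ) = ((ℓ n : ℝ) + σs n) * ((ℓ n : ℝ) + σs n + ((d : ℝ) - 1)))
    (hh0 : Filter.Tendsto h Filter.atTop (nhds 0))
    (hspec : ∀ n, (h n) ^ (-2 : ℤ) ∉ laplaceSpec d)
    (β : EuclideanSpace ℂ (Fin 2)) (hβ : Filter.Tendsto βs Filter.atTop (nhds β)) (hβ0 : β ≠ 0)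
    (hpar : (∀ n, Even (ℓ n)) ∨ (∀ n, Odd (ℓ n)))
    (ρ : ℂ) (hρ : ∀ n, ρ = (-1) ^ (ℓ n))
    (σ : ℝ) (hσ : σ ∈ Set.Ioo (0 : ℝ) 1) (hσlim : Filter.Tendsto σs Filter.atTop (nhds σ)) :
    0 < quasimodeConst σ β ρ ∧
    ∃ C : ℝ, 1 < C ∧ ∀ Υ : ℕ, 1 ≤ Υ → ∃ ν : ℕ, ∀ n ≥ ν,
      Υ ≤ ℓ n ∧ greenComb (h n) (antipodalPair q) (βs n) ≠ 0 ∧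
      ‖normGreenComb (h n) (antipodalPair q) (βs n) -
          (1 / (quasimodeConst σ β ρ : ℂ)) •
            ∑ k ∈ Finset.Icc (-(Υ : ℤ)) (Υ : ℤ),
              ((β 0 + (-1 : ℂ) ^ k * ρ * β 1) / ((k : ℂ) - (σ : ℂ))) •
                normZonal ((ℓ n : ℤ) + k).toNat q‖
        ≤ C * ((Υ : ℝ) * h n + |σs n - σ| + ‖βs n - β‖ + (Υ : ℝ) ^ (-(1 / 2) : ℝ)) := by
  have hd2 : 2 ≤ d := by omega
  have hd3 : (d : ℝ) ≤ 3 := by exact_mod_cast (by omega : d ≤ 3)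
  have hd2' : (2 : ℝ) ≤ d := by exact_mod_cast hd2
  have hρ1 : ‖ρ‖ = 1 := by rw [hρ 0, norm_pow, norm_neg, norm_one, one_pow]
  obtain ⟨hσ0, hσ1⟩ := hσ
  obtain ⟨δ, hδ, hδσ, hδσ'⟩ : ∃ δ, 0 < δ ∧ δ < σ ∧ σ < 1 - δ := by
    have hmin : 0 < min σ (1 - σ) := lt_min hσ0 (by linarith)
    have hl := min_le_left σ (1 - σ)
    have hr := min_le_right σ (1 - σ)
    exact ⟨min σ (1 - σ) / 2, by linarith, by linarith, by linarith⟩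
  have hCpos : 0 < quasimodeConst σ β ρ := quasimodeConst_pos hδ hδσ.le hδσ'.le hβ0 hρ1
  refine ⟨hCpos, ?_⟩
  set Cq := quasimodeConst σ β ρ with hCq
  set B : ℝ := 2 * (‖β‖ + 1) with hB
  set A : ℝ := 4 * B * (2 / δ) ^ 2 with hA
  set S : ℝ := √(∑' k, intWeight k) with hS
  have hS0 : 0 ≤ S := Real.sqrt_nonneg _
  have hB1 : 1 ≤ B := by linarith [norm_nonneg β]
  have hA0 : 0 ≤ A := by positivity
  have hK : 2 / δ ≤ (2 / δ) ^ 2 := by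
    have : 1 ≤ 2 / δ := by rw [le_div_iff₀ hδ]; linarith
    nlinarith
  -- The fraction is the bound of `hfinal` divided by Cq and does not involve Υ; the summand 2 makes
  -- the constant exceed 1.
  refine ⟨2 + 4 * (A * (2 * S + 6)) / Cq, ?_, fun Υ hΥ => ?_⟩
  · have : 0 ≤ 4 * (A * (2 * S + 6)) / Cq := by positivity
    linarith
  -- The bound 1 keeps 2‖β_n‖ ≤ B, the bound ‖β‖ keeps β_n ≠ 0, and h < 1 / (Υ + d) forces ℓ_n > Υ.
  have hev : ∀ᶠ n in Filter.atTop, δ < σs n ∧ σs n < 1 - δ ∧ ‖βs n - β‖ < min 1 ‖β‖ ∧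
      h n < ((Υ : ℝ) + d)⁻¹ := by
    have e1 := hσlim.eventually (lt_mem_nhds hδσ)
    have e2 := hσlim.eventually (gt_mem_nhds hδσ')
    have e3 : ∀ᶠ n in Filter.atTop, ‖βs n - β‖ < min 1 ‖β‖ := by
      have := (tendsto_iff_norm_sub_tendsto_zero.1 hβ).eventually
        (gt_mem_nhds (lt_min one_pos (norm_pos_iff.2 hβ0)))
      exact this
    have e4 := hh0.eventually (gt_mem_nhds (by positivity : (0 : ℝ) < ((Υ : ℝ) + d)⁻¹))
    filter_upwards [e1, e2, e3, e4] with n h1 h2 h3 h4 using ⟨h1, h2, h3, h4⟩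
  obtain ⟨ν, hν⟩ := Filter.eventually_atTop.1 hev
  refine ⟨ν, fun n hn => ?_⟩
  obtain ⟨hs1, hs2, hβn, hhn⟩ := hν n hn
  have hh1 : 0 < h n := (hh n).1
  have hinv := inv_le_of_zpow_eq (by omega) (hσs n).1 (hσs n).2.le (hdef n)
  have hΥL : Υ ≤ ℓ n := by
    have h1 : (Υ : ℝ) + d < (h n)⁻¹ := by
      rwa [lt_inv_comm₀ (by positivity) hh1]
    have h2 : (Υ : ℝ) < ℓ n := by linarith
    exact_mod_cast h2.le
  have hβn1 : ‖βs n - β‖ < 1 := hβn.trans_le (min_le_left _ _)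
  have hβn2 : ‖βs n - β‖ < ‖β‖ := hβn.trans_le (min_le_right _ _)
  have hβsB : 2 * ‖βs n‖ ≤ B := by
    have := norm_le_norm_add_norm_sub' (βs n) β
    linarith
  have hβn0 : βs n ≠ 0 := fun h0 => by
    rw [h0, zero_sub, norm_neg] at hβn2
    exact lt_irrefl _ hβn2
  obtain ⟨hsum, hdist⟩ := norm_tsum_greenCoeff_sub_le hd q hΥ hΥL hδ hs1.le hs2.le hδσ.le hδσ'.le
    hρ1 hB1 (by linarith : 2 * ‖β‖ ≤ B) hβsB
  have hs0' : 0 < σs n := hδ.trans hs1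
  have hs1' : σs n < 1 := (hσs n).2
  have hne := tsum_greenCoeff_ne_zero hd2 q (ℓ n) hs0' hs1' hβn0 hρ1 hsum
  have hG := greenComb_eq hd2 q (ℓ n) hs0' hs1' (hdef n) (βs n)
  rw [← hρ n] at hG
  have hL1 : (1 : ℝ) ≤ ℓ n := by exact_mod_cast hΥ.trans hΥL
  have hτ : 0 < ‖zonalL2 (ℓ n) q‖ / (2 * (ℓ n : ℝ) + d - 1) :=
    div_pos (norm_zonalL2_pos (by omega) _ q) (by linarith)
  refine ⟨hΥL, ?_, ?_⟩
  · rw [hG]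
    exact smul_ne_zero (by exact_mod_cast hτ.ne') hne
  rw [normGreenComb, hG, normalize_smul_of_pos hτ]
  have hT := abs_quasimodeConst_sub_norm_le (orthonormal_normZonal (by omega : 0 < d) q) hΥ hΥL hδ
    hδσ.le hδσ'.le β hρ1
  have hnorm := norm_normalize_sub_le hne hCpos (y := ∑ k ∈ Finset.Icc (-(Υ : ℤ)) (Υ : ℤ),
    (amplitude β ρ k / ((k : ℂ) - (σ : ℂ))) • normZonal ((ℓ n : ℤ) + k).toNat q)
  refine hnorm.trans ?_
  set r : ℝ := (Υ : ℝ) ^ (-(1 / 2) : ℝ) with hr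
  have hr0 : 0 ≤ r := by positivity
  have hL0 : (0 : ℝ) < ℓ n := by linarith
  -- Here h⁻¹ ≤ ℓ_n + d ≤ 4 ℓ_n, because d ≤ 3 and ℓ_n ≥ 1.
  have hη : (Υ : ℝ) / ℓ n ≤ 4 * (Υ * h n) := by
    have h1 : 1 ≤ h n * (ℓ n + d) := by
      have := mul_le_mul_of_nonneg_left hinv hh1.le
      rwa [mul_inv_cancel₀ hh1.ne'] at this
    have h2 : 1 ≤ 4 * h n * ℓ n := by nlinarith
    rw [div_le_iff₀ hL0]
    have hΥ0 : (0 : ℝ) ≤ Υ := Υ.cast_nonneg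
    nlinarith
  have hT' : |Cq - ‖∑ k ∈ Finset.Icc (-(Υ : ℤ)) (Υ : ℤ),
      (amplitude β ρ k / ((k : ℂ) - (σ : ℂ))) • normZonal ((ℓ n : ℤ) + k).toNat q‖| ≤
      A * (2 * r) := by
    refine hT.trans ?_
    gcongr
    rw [hA]
    have h1 : 2 * ‖β‖ ≤ 4 * B := by linarith [norm_nonneg β]
    exact mul_le_mul h1 hK (by positivity) (by positivity)
  set ε : ℝ := (Υ : ℝ) * h n + |σs n - σ| + ‖βs n - β‖ + r with hε
  have hε0 : 0 ≤ ε := by positivity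
  have hηε : (Υ : ℝ) / ℓ n + |σs n - σ| + ‖βs n - β‖ ≤ 4 * ε := by
    linarith [abs_nonneg (σs n - σ), norm_nonneg (βs n - β)]
  have hrε : r ≤ 4 * ε := by
    have : 0 ≤ (Υ : ℝ) * h n := by positivity
    linarith [abs_nonneg (σs n - σ), norm_nonneg (βs n - β)]
  have hfinal : 2 * ‖∑' l, greenCoeff q (ℓ n) (σs n) (βs n) ρ l • normZonal l q -
        ∑ k ∈ Finset.Icc (-(Υ : ℤ)) (Υ : ℤ),
          (amplitude β ρ k / ((k : ℂ) - (σ : ℂ))) • normZonal ((ℓ n : ℤ) + k).toNat q‖ +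
      |Cq - ‖∑ k ∈ Finset.Icc (-(Υ : ℤ)) (Υ : ℤ),
          (amplitude β ρ k / ((k : ℂ) - (σ : ℂ))) • normZonal ((ℓ n : ℤ) + k).toNat q‖| ≤
      4 * (A * (2 * S + 6)) * ε := by
    calc _ ≤ 2 * (A * (S * (4 * ε) + 2 * (4 * ε))) + A * (2 * (4 * ε)) := by
          refine add_le_add (mul_le_mul_of_nonneg_left (hdist.trans ?_) zero_le_two)
            (hT'.trans ?_)
          · gcongr
          · gcongr
      _ = _ := by ring
  calc _ ≤ 4 * (A * (2 * S + 6)) * ε / Cq := div_le_div_of_nonneg_right hfinal hCpos.le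
    _ = 4 * (A * (2 * S + 6)) / Cq * ε := by ring
    _ ≤ _ := by gcongr; linarith
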